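/- Lemma (Dominating Set Algorithm). There are a deterministic algorithm and polynomials $p$, $q$ such that the following holds. Let $G$ be a connected graph with $n$ vertices and $m$ edges, and let $G'$ be a graph obtained by starting with $G$ and repeatedly deleting vertices of degree one (degrees being taken in the current graph) until no vertices of degree one remain. Suppose that at most $n/5$ vertices were deleted from $G$ to produce $G'$. Then, on input $G$, the algorithm halts and outputs a minimum-size dominating set of $G'$, using time at most $p(n)\cdot 2^{m-3n/5}$ (that is, $O^*(2^{m-3n/5})$ time) and space at most $q(n)$ (that is, polynomial space). Here a dominating set of a graph is a set $D$ of vertices such that every vertex of the graph is in $D$ or adjacent to a vertex in $D$; algorithms are programs of a random access machine with logarithmic time cost, space is counted in bits, and $G$ is given by its adjacency matrix. -/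

import Mathlib

/-! ## Graphs -/

/-- `D` is a dominating set of `G`: every vertex lies in `D` or is adjacent to a vertex of `D`. -/
def SimpleGraph.IsDominatingSet {V : Type*} (G : SimpleGraph V) (D : Set V) : Prop :=
  ∀ v, v ∈ D ∨ ∃ w ∈ D, G.Adj v w

/-- `D` is a dominating set of `G` of minimum cardinality. -/
def SimpleGraph.IsMinimumDominatingSet {V : Type*} (G : SimpleGraph V) (D : Set V) : Prop :=
  G.IsDominatingSet D ∧ ∀ D' : Set V, G.IsDominatingSet D' → D.encard ≤ D'.encard

/-- `W` arises from the vertex set `U` by deleting one vertex that has degree exactly one in the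
subgraph of `G` induced on `U`. -/
def SimpleGraph.DeletesDegreeOne {V : Type*} (G : SimpleGraph V) (U W : Set V) : Prop :=
  ∃ v : U, ((G.induce U).neighborSet v).encard = 1 ∧ W = U \ {(v : V)}

/-- The graph induced by `G` on `U` is obtained from `G` by repeatedly deleting vertices of degree
one until no vertex of degree one remains. -/
def SimpleGraph.IsDegreeOneReduction {V : Type*} (G : SimpleGraph V) (U : Set V) : Prop :=
  Relation.ReflTransGen G.DeletesDegreeOne Set.univ U ∧
    ∀ v : U, ((G.induce U).neighborSet v).encard ≠ 1

/-! ## Random access machines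

A deterministic random access machine with structured control flow. It has registers
`0, 1, 2, …`, which a program addresses directly, and arrays `0, 1, 2, …` of unbounded length, whose
cells it addresses through registers; a program, being finite, mentions finitely many registers
and arrays. Every register and cell holds a natural number. Time is charged by the bit lengths
of the numbers that are handled (the logarithmic cost criterion), and space is the number of bits
needed to write down the addresses and contents of all nonzero registers and cells. -/

namespace RAM

/-- The contents of the memory: `reg r` is register `r`, and `arr (k, i)` is cell `i` of
array `k`. All but finitely many of these are zero. -/
structure State where
  reg : ℕ →₀ ℕ
  arr : ℕ × ℕ →₀ ℕ

/-- The number of bits of memory in use. -/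
def State.bits (s : State) : ℕ :=
  (s.reg.sum fun r x => r.size + x.size) + s.arr.sum fun c x => c.1.size + c.2.size + x.size

/-- The arithmetic operations; `sub` is truncated and `div`, `mod` have their usual values
`a / 0 = 0` and `a % 0 = a` at zero. -/
inductive Op
  | add | sub | mul | div | mod

/-- The value of an arithmetic operation. -/
def Op.eval : Op → ℕ → ℕ → ℕ
  | .add, a, b => a + b
  | .sub, a, b => a - b
  | .mul, a, b => a * b
  | .div, a, b => a / b
  | .mod, a, b => a % b

/-- The instructions. -/
inductive Instr
  /-- `reg d := c` -/
  | const (d c : ℕ)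
  /-- `reg d := reg a ∘ reg b` -/
  | op (o : Op) (d a b : ℕ)
  /-- `reg d := arr (k, reg a)` -/
  | load (d k a : ℕ)
  /-- `arr (k, reg a) := reg b` -/
  | store (k a b : ℕ)

/-- The effect of an instruction. -/
noncomputable def Instr.exec : Instr → State → State
  | .const d c, s => { s with reg := s.reg.update d c }
  | .op o d a b, s => { s with reg := s.reg.update d (o.eval (s.reg a) (s.reg b)) }
  | .load d k a, s => { s with reg := s.reg.update d (s.arr (k, s.reg a)) }
  | .store k a b, s => { s with arr := s.arr.update (k, s.reg a) (s.reg b) }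

/-- The time taken by an instruction, in terms of the bit lengths of the numbers it handles. -/
def Instr.cost : Instr → State → ℕ
  | .const _ c, _ => c.size + 1
  | .op _ _ a b, s => ((s.reg a).size + 1) * ((s.reg b).size + 1)
  | .load _ k a, s => (s.reg a).size + (s.arr (k, s.reg a)).size + 1
  | .store _ a b, s => (s.reg a).size + (s.reg b).size + 1

/-- Programs: instructions, sequential composition, branching on `reg r ≠ 0`, and iteration
while `reg r ≠ 0`. -/
inductive Prog
  | instr (i : Instr)
  | seq (p q : Prog)
  | ite (r : ℕ) (p q : Prog)
  | loop (r : ℕ) (p : Prog)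

/-- `p.Runs s s' t b`: the program `p`, started in the state `s`, halts in the state `s'` after
time `t`, and the largest number of bits in use at any moment of this run is `b`. -/
inductive Prog.Runs : Prog → State → State → ℕ → ℕ → Prop
  | instr (i : Instr) (s : State) :
      Runs (.instr i) s (i.exec s) (i.cost s) (max s.bits (i.exec s).bits)
  | seq {p q : Prog} {s s₁ s₂ : State} {t₁ t₂ b₁ b₂ : ℕ} :
      Runs p s s₁ t₁ b₁ → Runs q s₁ s₂ t₂ b₂ →
      Runs (.seq p q) s s₂ (t₁ + t₂) (max b₁ b₂)
  | ite_true {r : ℕ} {p q : Prog} {s s' : State} {t b : ℕ} :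
      s.reg r ≠ 0 → Runs p s s' t b →
      Runs (.ite r p q) s s' ((s.reg r).size + 1 + t) b
  | ite_false {r : ℕ} {p q : Prog} {s s' : State} {t b : ℕ} :
      s.reg r = 0 → Runs q s s' t b →
      Runs (.ite r p q) s s' ((s.reg r).size + 1 + t) b
  | loop_stop {r : ℕ} {p : Prog} {s : State} :
      s.reg r = 0 →
      Runs (.loop r p) s s ((s.reg r).size + 1) s.bits
  | loop_step {r : ℕ} {p : Prog} {s s₁ s₂ : State} {t₁ t₂ b₁ b₂ : ℕ} :
      s.reg r ≠ 0 → Runs p s s₁ t₁ b₁ → Runs (.loop r p) s₁ s₂ t₂ b₂ →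
      Runs (.loop r p) s s₂ ((s.reg r).size + 1 + t₁ + t₂) (max b₁ b₂)

open Classical in
/-- The initial state on the input graph `G` with vertices `0, …, n - 1`: register `0` holds `n`,
array `0` holds the adjacency matrix of `G` row by row, and everything else is zero. -/
noncomputable def inputState {n : ℕ} (G : SimpleGraph (Fin n)) : State where
  reg := Finsupp.single 0 n
  arr := Finsupp.onFinset ({0} ×ˢ Finset.range (n * n))
    (fun c => if ∃ i j : Fin n, G.Adj i j ∧ c = (0, (i : ℕ) * n + j) then 1 else 0) (by
      intro c hc
      obtain ⟨i, j, -, rfl⟩ : ∃ i j : Fin n, G.Adj i j ∧ c = (0, (i : ℕ) * n + j) := by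
        by_contra h
        exact hc (if_neg h)
      have hi := i.isLt
      have hj := j.isLt
      simp only [Finset.mem_product, Finset.mem_singleton, Finset.mem_range, true_and]
      nlinarith)

/-- The set `S ⊆ {0, …, n - 1}` is the output of a computation that halts in the state `s`: the
first `n` cells of array `1` hold the characteristic vector of `S`. -/
def State.Outputs {n : ℕ} (s : State) (S : Set (Fin n)) : Prop :=
  ∀ v : Fin n, (v ∈ S → s.arr (1, (v : ℕ)) = 1) ∧ (v ∉ S → s.arr (1, (v : ℕ)) = 0)

end RAM

/-! Deleting a vertex of degree one keeps a connected graph connected and removes one edge, so the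
reduced graph, with `c` vertices, is connected and has at most `m - n + c` edges. Outside a spanning
tree of it lie `f ≤ m - n + 1` edges.

Let `D` be a dominating set of the reduced graph. A non-tree edge helps to dominate a vertex outside
`D` only if exactly one of its ends is in `D`. Three cases per edge (first end only, second end
only, anything else) thus give `3 ^ f` guesses. For the right guess, put the guessed ends into the
set and mark their neighbours as dominated; every other vertex must then be dominated by itself or
along a tree edge. That problem on a tree is solved greedily from the leaves to the root: an
undominated leaf selects its parent, and an exchange argument shows that this costs nothing. Every
guess yields a dominating set and the right one yields a set no larger than `D`, so the smallest
result is a minimum.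

Alternatively `D` itself is guessed, in `2 ^ c` ways. The cheaper system has `min (3 ^ f) (2 ^ c) ≤
(3 ^ f) ^ (3/5) * (2 ^ c) ^ (2/5) ≤ 2 ^ (f + 2c/5)` guesses, because `27 ≤ 32`; with `c ≤ n` this is
at most `2 * 2 ^ (m - 3n/5)`.

The bound on the number of deletions makes the reduction unique; in general a tree shrinks to
different single vertices, depending on the order of deletion.

On the machine, with `N = n ^ 2 + n + 4`, all values stay below `4 ^ N`, so that each instruction
costs at most `(2 * N + 1) ^ 2` and memory is polynomial. Every loop except the one over the guesses
makes at most `N` rounds. The main lemmas are `IsResidual.step` (greedy), `IsGuessSystem.of_edges`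
(guesses), `IsTreeOrder.card_nonTreeEdges_add_le`, `reduction_card` and `min_pow_five_le`
(counting), `reduction_unique`, and `WPT.forLoop` (time). -/

namespace RAM

/-! ## A program logic with time and space bounds -/

infixr:60 " ⨟ " => Prog.seq

/-- `s` with `reg d := v`. -/
noncomputable def State.setReg (s : State) (d v : ℕ) : State := { s with reg := s.reg.update d v }

/-- `s` with `arr (k, i) := v`. -/
noncomputable def State.setArr (s : State) (k i v : ℕ) : State :=
  { s with arr := s.arr.update (k, i) v }

@[simp] theorem State.setReg_reg (s : State) (d v r : ℕ) :
    (s.setReg d v).reg r = if r = d then v else s.reg r := by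
  simp [State.setReg, Function.update_apply]

@[simp] theorem State.setReg_arr (s : State) (d v : ℕ) : (s.setReg d v).arr = s.arr := rfl

@[simp] theorem State.setArr_reg (s : State) (k i v : ℕ) : (s.setArr k i v).reg = s.reg := rfl

@[simp] theorem State.setArr_arr (s : State) (k i v k' i' : ℕ) :
    (s.setArr k i v).arr (k', i') = if k' = k ∧ i' = i then v else s.arr (k', i') := by
  simp [State.setArr, Function.update_apply]

/-- The registers that a program may write. -/
def Prog.wr : Prog → List ℕ
  | .instr (.const d _) => [d]
  | .instr (.op _ d _ _) => [d]
  | .instr (.load d _ _) => [d]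
  | .instr (.store _ _ _) => []
  | .seq p q => p.wr ++ q.wr
  | .ite _ p q => p.wr ++ q.wr
  | .loop _ p => p.wr

/-- The arrays that a program may write. -/
def Prog.wa : Prog → List ℕ
  | .instr (.const _ _) => []
  | .instr (.op _ _ _ _) => []
  | .instr (.load _ _ _) => []
  | .instr (.store k _ _) => [k]
  | .seq p q => p.wa ++ q.wa
  | .ite _ p q => p.wa ++ q.wa
  | .loop _ p => p.wa

/-- `s` and `s'` agree off the registers `R` and the arrays `K`. -/
structure SameOff (R K : List ℕ) (s s' : State) : Prop where
  reg : ∀ r, r ∉ R → s'.reg r = s.reg r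
  arr : ∀ k, k ∉ K → ∀ i, s'.arr (k, i) = s.arr (k, i)

theorem SameOff.rfl {R K : List ℕ} {s : State} : SameOff R K s s :=
  ⟨fun _ _ => Eq.refl _, fun _ _ _ => Eq.refl _⟩

theorem SameOff.trans {R K : List ℕ} {s s' s'' : State} (h : SameOff R K s s')
    (h' : SameOff R K s' s'') : SameOff R K s s'' :=
  ⟨fun r hr => (h'.reg r hr).trans (h.reg r hr),
    fun k hk i => (h'.arr k hk i).trans (h.arr k hk i)⟩

theorem SameOff.mono {R R' K K' : List ℕ} {s s' : State} (h : SameOff R K s s')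
    (hR : R ⊆ R') (hK : K ⊆ K') : SameOff R' K' s s' :=
  ⟨fun r hr => h.reg r fun h => hr (hR h), fun k hk => h.arr k fun h => hk (hK h)⟩

/-- The frame rule. Registers and arrays are named statically in the program text, so for concrete
programs `decide` settles what survives a run. -/
theorem Prog.Runs.sameOff {p : Prog} {s s' : State} {t b : ℕ} (h : p.Runs s s' t b) :
    SameOff p.wr p.wa s s' := by
  induction h with
  | instr i s =>
    cases i <;> constructor <;> intro r hr <;>
      simp_all [Prog.wr, Prog.wa, Instr.exec]
  | seq _ _ h1 h2 =>
    exact (h1.mono (by simp [Prog.wr]) (by simp [Prog.wa])).trans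
      (h2.mono (by simp [Prog.wr]) (by simp [Prog.wa]))
  | ite_true _ _ h => exact h.mono (by simp [Prog.wr]) (by simp [Prog.wa])
  | ite_false _ _ h => exact h.mono (by simp [Prog.wr]) (by simp [Prog.wa])
  | loop_stop _ => exact .rfl
  | loop_step _ _ _ h1 h2 => exact SameOff.trans h1 h2

/-- All values are below `4 ^ N`, and only registers below `64` and cells below `N` of arrays
below `16` are in use. -/
structure Bounded (N : ℕ) (s : State) : Prop where
  reg_zero : ∀ r, 64 ≤ r → s.reg r = 0
  reg_lt : ∀ r, s.reg r < 4 ^ N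
  arr_zero : ∀ k i, 16 ≤ k ∨ N ≤ i → s.arr (k, i) = 0
  arr_lt : ∀ c, s.arr c < 4 ^ N

theorem size_le_of_lt_four_pow {x N : ℕ} (h : x < 4 ^ N) : x.size ≤ 2 * N := by
  rw [Nat.size_le, pow_mul]
  exact h

/-- A bound on the number of bits of a bounded state. -/
def bitBound (N : ℕ) : ℕ := 64 * (6 + 2 * N) + 16 * N * (4 + N + 2 * N)

theorem Bounded.bits_le {N : ℕ} {s : State} (h : Bounded N s) : s.bits ≤ bitBound N := by
  refine add_le_add ?_ ?_
  · have hsub : s.reg.support ⊆ Finset.range 64 := fun r hr => by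
      by_contra hc
      exact (Finsupp.mem_support_iff.1 hr) (h.reg_zero r (by simpa using hc))
    refine (Finset.sum_le_card_nsmul _ _ (6 + 2 * N) fun r hr => ?_).trans ?_
    · have h1 : r.size ≤ 6 := Nat.size_le.2 (by simpa using hsub hr)
      have h2 := size_le_of_lt_four_pow (h.reg_lt r)
      show r.size + (s.reg r).size ≤ _
      omega
    · have := Finset.card_le_card hsub
      simp only [Finset.card_range] at this
      simp only [smul_eq_mul]
      gcongr
  · have hsub : s.arr.support ⊆ Finset.range 16 ×ˢ Finset.range N := fun c hc => by
      by_contra hcon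
      refine (Finsupp.mem_support_iff.1 hc) (h.arr_zero c.1 c.2 ?_)
      simp only [Finset.mem_product, Finset.mem_range] at hcon
      omega
    refine (Finset.sum_le_card_nsmul _ _ (4 + N + 2 * N) fun c hc => ?_).trans ?_
    · have hc' := hsub hc
      simp only [Finset.mem_product, Finset.mem_range] at hc'
      have h1 : c.1.size ≤ 4 := Nat.size_le.2 (by simpa using hc'.1)
      have h2 : c.2.size ≤ N := Nat.size_le.2 (hc'.2.trans Nat.lt_two_pow_self)
      have h3 := size_le_of_lt_four_pow (h.arr_lt c)
      show c.1.size + c.2.size + (s.arr c).size ≤ _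
      omega
    · have := Finset.card_le_card hsub
      simp only [Finset.card_product, Finset.card_range] at this
      simp only [smul_eq_mul]
      gcongr

theorem Bounded.setReg {N : ℕ} {s : State} (h : Bounded N s) {d v : ℕ} (hd : d < 64)
    (hv : v < 4 ^ N) : Bounded N (s.setReg d v) where
  reg_zero r hr := by
    rw [State.setReg_reg, if_neg (by omega)]
    exact h.reg_zero r hr
  reg_lt r := by
    rw [State.setReg_reg]
    split
    · exact hv
    · exact h.reg_lt r
  arr_zero := h.arr_zero
  arr_lt := h.arr_lt

theorem Bounded.setArr {N : ℕ} {s : State} (h : Bounded N s) {k i v : ℕ} (hk : k < 16)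
    (hi : i < N) (hv : v < 4 ^ N) : Bounded N (s.setArr k i v) where
  reg_zero := h.reg_zero
  reg_lt := h.reg_lt
  arr_zero k' i' hr := by
    rw [State.setArr_arr, if_neg (by omega)]
    exact h.arr_zero k' i' hr
  arr_lt c := by
    rw [← Prod.mk.eta (p := c), State.setArr_arr]
    split
    · exact hv
    · exact h.arr_lt _

/-- A bound on the time of a program, in multiples of the cost of a single instruction, if each
execution of one of its loops takes at most `N` rounds. -/
def Prog.steps (N : ℕ) : Prog → ℕ
  | .instr _ => 1
  | .seq p q => p.steps N + q.steps N
  | .ite _ p q => 1 + (p.steps N + q.steps N)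
  | .loop _ p => N * (1 + p.steps N) + 1

/-- Started in `s`, the program `p` halts after `T` steps at most, each of time at most
`(2 * N + 1) ^ 2`, in a state that satisfies `Q`; the memory stays bounded throughout. -/
def WPT (N T : ℕ) (p : Prog) (s : State) (Q : State → Prop) : Prop :=
  ∃ s' t b, p.Runs s s' t b ∧ t ≤ T * (2 * N + 1) ^ 2 ∧ b ≤ bitBound N ∧ Bounded N s' ∧ Q s'

/-- `WPT` with the number of steps computed from the program. -/
def WP (N : ℕ) (p : Prog) (s : State) (Q : State → Prop) : Prop :=
  WPT N (p.steps N) p s Q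

section Rules

variable {N T T' : ℕ} {p q : Prog} {s : State} {Q R : State → Prop}

theorem WPT.mono (h : WPT N T p s R) (hT : T ≤ T')
    (hQ : ∀ s', Bounded N s' → SameOff p.wr p.wa s s' → R s' → Q s') : WPT N T' p s Q := by
  obtain ⟨s', t, b, h1, h2, h3, h4, h5⟩ := h
  exact ⟨s', t, b, h1, h2.trans (Nat.mul_le_mul_right _ hT), h3, h4, hQ s' h4 h1.sameOff h5⟩

theorem WP.mono (h : WP N p s R)
    (hQ : ∀ s', Bounded N s' → SameOff p.wr p.wa s s' → R s' → Q s') : WP N p s Q :=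
  WPT.mono h le_rfl hQ

theorem WPT.seq (h : WPT N T p s R)
    (hQ : ∀ s', Bounded N s' → SameOff p.wr p.wa s s' → R s' → WPT N T' q s' Q) :
    WPT N (T + T') (p ⨟ q) s Q := by
  obtain ⟨s', t, b, h1, h2, h3, h4, h5⟩ := h
  obtain ⟨s'', t', b', h1', h2', h3', h4', h5'⟩ := hQ s' h4 h1.sameOff h5
  exact ⟨s'', _, _, .seq h1 h1', by rw [add_mul]; exact add_le_add h2 h2', max_le h3 h3', h4', h5'⟩

theorem WP.seq (h : WP N p s R)
    (hQ : ∀ s', Bounded N s' → SameOff p.wr p.wa s s' → R s' → WP N q s' Q) :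
    WP N (p ⨟ q) s Q :=
  WPT.seq h hQ

theorem size_succ_le (hs : Bounded N s) (r : ℕ) : (s.reg r).size + 1 ≤ (2 * N + 1) ^ 2 := by
  have h := size_le_of_lt_four_pow (hs.reg_lt r)
  nlinarith

theorem WP.instr {i : Instr} (hs : Bounded N s) (hs' : Bounded N (i.exec s))
    (hc : i.cost s ≤ (2 * N + 1) ^ 2) (hQ : Q (i.exec s)) : WP N (.instr i) s Q :=
  ⟨_, _, _, .instr i s, by simpa [Prog.steps] using hc, max_le hs.bits_le hs'.bits_le, hs', hQ⟩

theorem WP.const {d c : ℕ} (hs : Bounded N s) (hd : d < 64) (hc : c < 4 ^ N)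
    (hQ : Bounded N (s.setReg d c) → Q (s.setReg d c)) : WP N (.instr (.const d c)) s Q := by
  have hs' := hs.setReg hd hc
  refine WP.instr hs hs' ?_ (hQ hs')
  have h := size_le_of_lt_four_pow hc
  simp only [Instr.cost]
  nlinarith

theorem WP.op {o : Op} {d a b v : ℕ} (hs : Bounded N s) (hd : d < 64)
    (hv : o.eval (s.reg a) (s.reg b) = v) (hv' : v < 4 ^ N)
    (hQ : Bounded N (s.setReg d v) → Q (s.setReg d v)) : WP N (.instr (.op o d a b)) s Q := by
  subst hv
  have hs' := hs.setReg hd hv'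
  refine WP.instr hs hs' ?_ (hQ hs')
  have ha := size_le_of_lt_four_pow (hs.reg_lt a)
  have hb := size_le_of_lt_four_pow (hs.reg_lt b)
  simp only [Instr.cost]
  rw [sq]
  exact Nat.mul_le_mul (by omega) (by omega)

theorem WP.add {d a b v : ℕ} (hs : Bounded N s) (hv : s.reg a + s.reg b = v) (hv' : v < 4 ^ N)
    (hQ : Bounded N (s.setReg d v) → Q (s.setReg d v)) (hd : d < 64 := by decide) :
    WP N (.instr (.op .add d a b)) s Q :=
  WP.op hs hd hv hv' hQ

theorem WP.mul {d a b v : ℕ} (hs : Bounded N s) (hv : s.reg a * s.reg b = v) (hv' : v < 4 ^ N)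
    (hQ : Bounded N (s.setReg d v) → Q (s.setReg d v)) (hd : d < 64 := by decide) :
    WP N (.instr (.op .mul d a b)) s Q :=
  WP.op hs hd hv hv' hQ

/-- Differences, quotients and remainders never exceed the first operand, so these rules, unlike
those for `add` and `mul`, need no bound on the result. -/
theorem WP.sub {d a b v : ℕ} (hs : Bounded N s) (hv : s.reg a - s.reg b = v)
    (hQ : Bounded N (s.setReg d v) → Q (s.setReg d v)) (hd : d < 64 := by decide) :
    WP N (.instr (.op .sub d a b)) s Q :=
  WP.op hs hd hv (hv ▸ (Nat.sub_le _ _).trans_lt (hs.reg_lt a)) hQ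

theorem WP.div {d a b v : ℕ} (hs : Bounded N s) (hv : s.reg a / s.reg b = v)
    (hQ : Bounded N (s.setReg d v) → Q (s.setReg d v)) (hd : d < 64 := by decide) :
    WP N (.instr (.op .div d a b)) s Q :=
  WP.op hs hd hv (hv ▸ (Nat.div_le_self _ _).trans_lt (hs.reg_lt a)) hQ

theorem WP.mod {d a b v : ℕ} (hs : Bounded N s) (hv : s.reg a % s.reg b = v)
    (hQ : Bounded N (s.setReg d v) → Q (s.setReg d v)) (hd : d < 64 := by decide) :
    WP N (.instr (.op .mod d a b)) s Q :=
  WP.op hs hd hv (hv ▸ (Nat.mod_le _ _).trans_lt (hs.reg_lt a)) hQ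

theorem WP.load {d k a v : ℕ} (hs : Bounded N s) (hv : s.arr (k, s.reg a) = v)
    (hQ : Bounded N (s.setReg d v) → Q (s.setReg d v)) (hd : d < 64 := by decide) :
    WP N (.instr (.load d k a)) s Q := by
  subst hv
  have hs' := hs.setReg hd (hs.arr_lt (k, s.reg a))
  refine WP.instr hs hs' ?_ (hQ hs')
  have ha := size_le_of_lt_four_pow (hs.reg_lt a)
  have hb := size_le_of_lt_four_pow (hs.arr_lt (k, s.reg a))
  simp only [Instr.cost]
  nlinarith

theorem WP.store {k a b i v : ℕ} (hs : Bounded N s) (ha : s.reg a = i) (hb : s.reg b = v)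
    (hi : i < N) (hQ : Bounded N (s.setArr k i v) → Q (s.setArr k i v))
    (hk : k < 16 := by decide) : WP N (.instr (.store k a b)) s Q := by
  subst ha hb
  have hs' := hs.setArr hk hi (hs.reg_lt b)
  refine WP.instr hs hs' ?_ (hQ hs')
  have ha := size_le_of_lt_four_pow (hs.reg_lt a)
  have hb := size_le_of_lt_four_pow (hs.reg_lt b)
  simp only [Instr.cost]
  nlinarith

theorem WP.ite {r : ℕ} (hs : Bounded N s) (h1 : s.reg r ≠ 0 → WP N p s Q)
    (h2 : s.reg r = 0 → WP N q s Q) : WP N (.ite r p q) s Q := by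
  have hr := size_succ_le hs r
  by_cases h : s.reg r = 0
  · obtain ⟨s', t, b, h1, h2, h3⟩ := h2 h
    refine ⟨s', _, _, .ite_false h h1, ?_, h3⟩
    simp only [Prog.steps, add_mul]
    omega
  · obtain ⟨s', t, b, h1, h2, h3⟩ := h1 h
    refine ⟨s', _, _, .ite_true h h1, ?_, h3⟩
    simp only [Prog.steps, add_mul]
    omega

theorem WP.seq' (h : WP N p s fun s' => WP N q s' Q) : WP N (p ⨟ q) s Q :=
  WP.seq h fun _ _ _ h => h

/-- `for reg r := 0, …, reg b - 1 do body`; register `r + 1` is used for the loop test, and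
register `1` is to hold the number `1`. -/
def forLoop (r b : ℕ) (body : Prog) : Prog :=
  .instr (.const r 0) ⨟ .instr (.op .sub (r + 1) b r) ⨟
    .loop (r + 1) (body ⨟ .instr (.op .add r r 1) ⨟ .instr (.op .sub (r + 1) b r))

/-- The rounds are counted by the value `M` of the bound, not by `N`, so that the exponential loop
over the guesses can be charged exactly. A round costs its body, the loop test and two updates;
entering and leaving cost three more steps. The invariant must ignore the two counter registers,
which change between rounds. -/
theorem WPT.forLoop {r b M : ℕ} {body : Prog} {I : ℕ → State → Prop} (hs : Bounded N s)
    (hb : s.reg b = M) (hM : M < 4 ^ N) (h1 : s.reg 1 = 1)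
    (hside : r + 1 < 64 ∧ b ≠ r ∧ b ≠ r + 1 ∧ r ≠ 1 ∧ r ≠ 0 ∧
      r ∉ body.wr ∧ b ∉ body.wr ∧ 1 ∉ body.wr)
    (hI : ∀ i s u v, I i s → I i ((s.setReg r u).setReg (r + 1) v)) (h0 : I 0 s)
    (hstep : ∀ i s', i < M → Bounded N s' → SameOff (r :: (r + 1) :: body.wr) body.wa s s' →
      s'.reg r = i → I i s' → WP N body s' (I (i + 1))) :
    WPT N (M * (body.steps N + 3) + 3) (RAM.forLoop r b body) s (I M) := by
  obtain ⟨hr, hbr, hbr', hr1, hr0, hw, hbw, h1w⟩ := hside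
  set L : Prog := body ⨟ .instr (.op .add r r 1) ⨟ .instr (.op .sub (r + 1) b r) with hL
  -- Induction on the number `k` of remaining rounds, which is the value of the test register.
  have key : ∀ k i s', i + k = M → Bounded N s' →
      SameOff (r :: (r + 1) :: body.wr) body.wa s s' → s'.reg r = i → s'.reg (r + 1) = k →
      I i s' → WPT N (k * (body.steps N + 3) + 1) (.loop (r + 1) L) s' (I M) := by
    intro k
    induction k with
    | zero =>
      intro i s' hik hs' hsame hri hrk hi
      refine ⟨s', _, _, Prog.Runs.loop_stop hrk, ?_, hs'.bits_le, hs', by simpa [← hik] using hi⟩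
      simpa using size_succ_le hs' (r + 1)
    | succ k ih =>
      intro i s' hik hs' hsame hri hrk hi
      have hbody : WP N L s' (fun s'' => SameOff (r :: (r + 1) :: body.wr) body.wa s s'' ∧
          s''.reg r = i + 1 ∧ s''.reg (r + 1) = k ∧ I (i + 1) s'') := by
        refine WP.seq (hstep i s' (by omega) hs' hsame hri hi) fun s₁ hs₁ hsame₁ hi₁ => ?_
        have e1 : s₁.reg r = i := (hsame₁.reg r hw).trans hri
        have e2 : s₁.reg 1 = 1 := by
          rw [hsame₁.reg 1 h1w, hsame.reg 1 (by simp [h1w, Ne.symm hr1, hr0]), h1]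
        have e3 : s₁.reg b = M := by
          rw [hsame₁.reg b hbw, hsame.reg b (by simp [hbr, hbr', hbw]), hb]
        refine WP.seq' (WP.add hs₁ (v := i + 1) (by omega) (by omega) (fun hs₂ => ?_) (by omega))
        refine WP.sub hs₂ (v := k) (by simp [hbr, e3]; omega) (fun hs₃ => ?_) hr
        refine ⟨?_, by simp, by simp, hI _ _ _ _ hi₁⟩
        refine hsame.trans ⟨fun x hx => ?_, fun x hx j => ?_⟩
        · simp only [List.mem_cons, not_or] at hx
          simp [hx.1, hx.2.1, hsame₁.reg x hx.2.2]
        · simpa using hsame₁.arr x hx j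
      obtain ⟨s'', t, b', g1, g2, g3, g4, g5, g6, g7, g8⟩ := hbody
      obtain ⟨s₃, t', b'', k1, k2, k3, k4, k5⟩ := ih (i + 1) s'' (by omega) g4 g5 g6 g7 g8
      refine ⟨s₃, _, _, .loop_step (by omega) g1 k1, ?_, max_le g3 k3, k4, k5⟩
      have hsz := size_succ_le hs' (r + 1)
      have hst : L.steps N = body.steps N + 2 := by simp [hL, Prog.steps]
      rw [hst] at g2
      nlinarith
  refine (WPT.seq (T := 1) (R := fun s₁ => s₁ = s.setReg r 0)
    (WP.const hs (by omega) (by positivity) fun _ => rfl) fun s₁ hs₁ hsame₁ h => ?_).mono (Q := I M) (T' := M * (body.steps N + 3) + 3)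
      (T := 1 + (1 + (M * (body.steps N + 3) + 1))) (by omega) fun _ _ _ h => h
  subst h
  refine WPT.seq (T := 1) (R := fun s₂ => s₂ = (s.setReg r 0).setReg (r + 1) M)
    (WP.sub hs₁ (v := M) (by simp [hbr, hb]) (fun hs₂ => rfl) hr) fun s₂ hs₂ hsame₂ h => ?_
  subst h
  refine key M 0 _ (by omega) hs₂ ⟨fun x hx => ?_, fun _ _ _ => rfl⟩ (by simp) (by simp)
    (hI _ _ _ _ h0)
  simp only [List.mem_cons, not_or] at hx
  simp [hx.1, hx.2.1]

/-- A loop with at most `N` rounds fits into the budget of `Prog.steps`, so no count has to be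
carried along. -/
theorem WP.forLoop {r b M : ℕ} {body : Prog} {I : ℕ → State → Prop} (hs : Bounded N s)
    (hb : s.reg b = M) (hM : M ≤ N) (h1 : s.reg 1 = 1)
    (hside : r + 1 < 64 ∧ b ≠ r ∧ b ≠ r + 1 ∧ r ≠ 1 ∧ r ≠ 0 ∧
      r ∉ body.wr ∧ b ∉ body.wr ∧ 1 ∉ body.wr)
    (hI : ∀ i s u v, I i s → I i ((s.setReg r u).setReg (r + 1) v)) (h0 : I 0 s)
    (hstep : ∀ i s', i < M → Bounded N s' → SameOff (r :: (r + 1) :: body.wr) body.wa s s' →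
      s'.reg r = i → I i s' → WP N body s' (I (i + 1))) :
    WP N (RAM.forLoop r b body) s (I M) := by
  refine (WPT.forLoop hs hb (hM.trans_lt (Nat.lt_pow_self (by norm_num))) h1 hside hI h0
    hstep).mono ?_ fun _ _ _ h => h
  have : M * (body.steps N + 3) ≤ N * (body.steps N + 3) := Nat.mul_le_mul_right _ hM
  simp only [RAM.forLoop, Prog.steps]
  nlinarith

end Rules

/-- As `N` is a polynomial in `n`, everything but the number of guesses contributes only a
polynomial factor. -/
theorem Prog.exists_polynomial_steps (p : Prog) :
    ∃ P : Polynomial ℕ, ∀ N, p.steps N = P.eval N := by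
  induction p with
  | instr i => exact ⟨1, fun N => by simp [Prog.steps]⟩
  | seq p q hp hq =>
    obtain ⟨P, hP⟩ := hp
    obtain ⟨Q, hQ⟩ := hq
    exact ⟨P + Q, fun N => by simp [Prog.steps, hP, hQ]⟩
  | ite r p q hp hq =>
    obtain ⟨P, hP⟩ := hp
    obtain ⟨Q, hQ⟩ := hq
    exact ⟨1 + (P + Q), fun N => by simp [Prog.steps, hP, hQ]⟩
  | loop r p hp =>
    obtain ⟨P, hP⟩ := hp
    exact ⟨.X * (1 + P) + 1, fun N => by simp [Prog.steps, hP]⟩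

end RAM

/-! ## Vertex orders along a spanning tree -/

/-- `ord 0, …, ord (cnt - 1)` enumerates `S` so that each vertex but the first is preceded by its
neighbour `par`. -/
structure IsTreeOrder (H : SimpleGraph ℕ) (S : Finset ℕ) (cnt : ℕ) (ord par : ℕ → ℕ) : Prop where
  mem : ∀ t < cnt, ord t ∈ S
  surj : ∀ v ∈ S, ∃ t < cnt, ord t = v
  inj : ∀ s < cnt, ∀ t < cnt, ord s = ord t → s = t
  root : par (ord 0) = ord 0
  par : ∀ t, 0 < t → t < cnt → ∃ s < t, par (ord t) = ord s ∧ H.Adj (ord t) (ord s)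

namespace IsTreeOrder

variable {H : SimpleGraph ℕ} {S : Finset ℕ} {cnt : ℕ} {ord par : ℕ → ℕ}

theorem card_eq (h : IsTreeOrder H S cnt ord par) : S.card = cnt := by
  have : S = (Finset.range cnt).image ord := by
    ext v
    simp only [Finset.mem_image, Finset.mem_range]
    exact ⟨fun hv => h.surj v hv, fun ⟨t, ht, hv⟩ => hv ▸ h.mem t ht⟩
  rw [this, Finset.card_image_of_injOn, Finset.card_range]
  intro s hs t ht hst
  exact h.inj s (by simpa using hs) t (by simpa using ht) hst

theorem singleton {r : ℕ} (h0 : ord 0 = r) (hr : par r = r) :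
    IsTreeOrder H {r} 1 ord par where
  mem t ht := by simp_all
  surj v hv := ⟨0, by simp_all⟩
  inj s hs t ht _ := by omega
  root := by simp_all
  par t ht ht' := by omega

/-- Attaching a leaf. The new functions are constrained only where it matters, to match memory after
the stores. -/
theorem insert {ord' par' : ℕ → ℕ} {i j : ℕ} (h : IsTreeOrder H S cnt ord par) (hi : i ∈ S)
    (hj : j ∉ S) (hij : H.Adj i j) (ho : ∀ t < cnt, ord' t = ord t) (ho' : ord' cnt = j)
    (hp : ∀ v, v ≠ j → par' v = par v) (hp' : par' j = i) :
    IsTreeOrder H (insert j S) (cnt + 1) ord' par' := by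
  obtain ⟨t₀, ht₀, hti⟩ := h.surj i hi
  have hne : ∀ t < cnt, ord t ≠ j := fun t ht e => hj (e ▸ h.mem t ht)
  refine ⟨fun t ht => ?_, fun v hv => ?_, fun s hs t ht hst => ?_, ?_, fun t h0 ht => ?_⟩
  · rcases Nat.lt_succ_iff_lt_or_eq.1 ht with ht | rfl
    · rw [ho t ht]; exact Finset.mem_insert_of_mem (h.mem t ht)
    · rw [ho']; exact Finset.mem_insert_self _ _
  · rcases Finset.mem_insert.1 hv with rfl | hv
    · exact ⟨cnt, by omega, ho'⟩
    · obtain ⟨t, ht, e⟩ := h.surj v hv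
      exact ⟨t, by omega, by rw [ho t ht, e]⟩
  · rcases Nat.lt_succ_iff_lt_or_eq.1 hs with hs | rfl <;>
      rcases Nat.lt_succ_iff_lt_or_eq.1 ht with ht | rfl
    · rw [ho s hs, ho t ht] at hst; exact h.inj s hs t ht hst
    · rw [ho s hs, ho'] at hst; exact absurd hst (hne s hs)
    · rw [ho t ht, ho'] at hst; exact absurd hst.symm (hne t ht)
    · rfl
  · rw [ho 0 (by omega), hp _ (hne 0 (by omega)), h.root]
  · rcases Nat.lt_succ_iff_lt_or_eq.1 ht with ht | rfl
    · obtain ⟨s, hs, e⟩ := h.par t h0 ht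
      exact ⟨s, hs, by rw [ho t ht, ho s (by omega), hp _ (hne t ht)]; exact e⟩
    · exact ⟨t₀, ht₀, by rw [ho', ho t₀ ht₀, hp', hti]; exact ⟨rfl, hij.symm⟩⟩

theorem par_mem (h : IsTreeOrder H S cnt ord par) {v : ℕ} (hv : v ∈ S) : par v ∈ S := by
  obtain ⟨t, ht, rfl⟩ := h.surj v hv
  rcases Nat.eq_zero_or_pos t with rfl | h0
  · rwa [h.root]
  · obtain ⟨s, hs, e, -⟩ := h.par t h0 ht
    rw [e]; exact h.mem s (by omega)

theorem par_eq_or_adj (h : IsTreeOrder H S cnt ord par) {v : ℕ} (hv : v ∈ S) :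
    par v = v ∨ H.Adj v (par v) := by
  obtain ⟨t, ht, rfl⟩ := h.surj v hv
  rcases Nat.eq_zero_or_pos t with rfl | h0
  · exact .inl h.root
  · obtain ⟨s, hs, e, ha⟩ := h.par t h0 ht
    exact .inr (by rwa [e])

/-- Parents precede their children and the root is its own parent. Hence the last vertex of an
initial segment is a leaf of the tree on that segment. -/
theorem par_ne (h : IsTreeOrder H S cnt ord par) {s m : ℕ} (hs : s < m) (hm : m < cnt) :
    par (ord s) ≠ ord m := by
  intro e
  rcases Nat.eq_zero_or_pos s with rfl | h0
  · rw [h.root] at e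
    exact absurd (h.inj 0 (by omega) m hm e) (by omega)
  · obtain ⟨s', hs', e', -⟩ := h.par s h0 (by omega)
    rw [e'] at e
    exact absurd (h.inj s' (by omega) m hm e) (by omega)

end IsTreeOrder

/-! ## Dominating sets with a prescribed part, greedily along a tree -/

/-- `D` is a solution of the problem that remains when all but the first `m` vertices of the order
have been treated, the vertices of `I` have been chosen, and those of `M` have been dominated:
only tree edges may be used to dominate the other vertices. -/
structure IsResidual (cnt : ℕ) (ord par : ℕ → ℕ) (m : ℕ) (I M D : Finset ℕ) : Prop where
  sub : I ⊆ D
  done : ∀ s, m ≤ s → s < cnt → ord s ∈ D → ord s ∈ I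
  todo : ∀ s < m, ord s ∈ M ∨ ord s ∈ D ∨ par (ord s) ∈ D ∨
    ∃ s' < m, par (ord s') = ord s ∧ ord s' ∈ D

/-- One step of the greedy algorithm: the chosen vertices. -/
def greedyIn (v p : ℕ) (I M : Finset ℕ) : Finset ℕ :=
  if v ∈ I then I else if v ∈ M then I else insert p I

/-- One step of the greedy algorithm: the vertices marked as dominated. -/
def greedyDom (v p : ℕ) (I M : Finset ℕ) : Finset ℕ :=
  if v ∈ I then insert p M else M

namespace IsResidual

variable {H : SimpleGraph ℕ} {S : Finset ℕ} {cnt : ℕ} {ord par : ℕ → ℕ} {m : ℕ}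
  {I M D : Finset ℕ}

/-- Among the first `m + 1` vertices, `ord m` is a leaf and can dominate only itself and its parent.
Once it no longer needs to be dominated, its parent does at least as well in its place. -/
theorem exchange (h : IsTreeOrder H S cnt ord par) (hm : m < cnt) (h0 : 0 < m)
    (hD : IsResidual cnt ord par (m + 1) I M D) (hv : ord m ∉ I) :
    IsResidual cnt ord par m I M (insert (par (ord m)) (D.erase (ord m))) := by
  obtain ⟨s₀, hs₀, hp, -⟩ := h.par m h0 hm
  refine ⟨fun x hx => ?_, fun s hs hs' hsD => ?_, fun s hs => ?_⟩
  · have : x ≠ ord m := fun e => hv (e ▸ hx)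
    simp [this, hD.sub hx]
  · simp only [Finset.mem_insert, Finset.mem_erase] at hsD
    rcases hsD with e | ⟨hne, hsD⟩
    · rw [hp] at e
      have := h.inj s hs' s₀ (by omega) e
      omega
    · have : s ≠ m := fun e => hne (by rw [e])
      exact hD.done s (by omega) hs' hsD
  · have hne : ∀ s < m, ord s ≠ ord m := fun s hs e => by
      have := h.inj s (by omega) m hm e
      omega
    simp only [Finset.mem_insert, Finset.mem_erase]
    rcases hD.todo s (by omega) with h1 | h1 | h1 | ⟨s', hs', h1, h2⟩
    · exact .inl h1
    · exact .inr (.inl (.inr ⟨hne s hs, h1⟩))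
    · exact .inr (.inr (.inl (.inr ⟨h.par_ne hs hm, h1⟩)))
    · rcases Nat.lt_succ_iff_lt_or_eq.1 hs' with hs' | rfl
      · exact .inr (.inr (.inr ⟨s', hs', h1, .inr ⟨hne s' hs', h2⟩⟩))
      · exact .inr (.inl (.inl h1.symm))

/-- Let `p` be the parent of the leaf `v`. If `v` is chosen, `p` is dominated for free. If `v` is
only marked, having `v` in `D` could help `p` alone, and `p` itself may replace it. Otherwise `v` or
`p` lies in `D`, and by exchange it may be taken to be `p`. At the root `p = v`, so the last case
chooses the root itself. -/
theorem step (h : IsTreeOrder H S cnt ord par) (hm : m < cnt)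
    (hD : IsResidual cnt ord par (m + 1) I M D) :
    ∃ D', IsResidual cnt ord par m (greedyIn (ord m) (par (ord m)) I M)
      (greedyDom (ord m) (par (ord m)) I M) D' ∧ D'.card ≤ D.card := by
  have hcard : ∀ p, ord m ∈ D → (insert p (D.erase (ord m))).card ≤ D.card := fun p hv => by
    refine (Finset.card_insert_le _ _).trans ?_
    rw [Finset.card_erase_of_mem hv]
    have := Finset.card_pos.2 ⟨_, hv⟩
    omega
  by_cases hI : ord m ∈ I
  · simp only [greedyIn, greedyDom, hI, if_true]
    refine ⟨D, ⟨hD.sub, fun s hs hs' hsD => ?_, fun s hs => ?_⟩, le_rfl⟩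
    · rcases eq_or_lt_of_le hs with rfl | hs
      · exact hI
      · exact hD.done s hs hs' hsD
    · rcases hD.todo s (by omega) with h1 | h1 | h1 | ⟨s', hs', h1, h2⟩
      · exact .inl (Finset.mem_insert_of_mem h1)
      · exact .inr (.inl h1)
      · exact .inr (.inr (.inl h1))
      · rcases Nat.lt_succ_iff_lt_or_eq.1 hs' with hs' | rfl
        · exact .inr (.inr (.inr ⟨s', hs', h1, h2⟩))
        · exact .inl (by simp [h1])
  simp only [greedyIn, greedyDom, hI, if_false]
  by_cases hM : ord m ∈ M
  · simp only [hM, if_true]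
    by_cases hv : ord m ∈ D
    · rcases Nat.eq_zero_or_pos m with rfl | h0
      -- The root has no other parent to move to, but nothing is left to dominate, so it is simply
      -- dropped.
      · refine ⟨D.erase (ord 0), ⟨fun x hx => ?_, fun s hs hs' hsD => ?_, fun s hs => by omega⟩,
          Finset.card_erase_le⟩
        · exact Finset.mem_erase.2 ⟨fun e => hI (e ▸ hx), hD.sub hx⟩
        · obtain ⟨h1, h2⟩ := Finset.mem_erase.1 hsD
          have : s ≠ 0 := fun e => h1 (by rw [e])
          exact hD.done s (by omega) hs' h2
      · exact ⟨_, hD.exchange h hm h0 hI, hcard _ hv⟩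
    · refine ⟨D, ⟨hD.sub, fun s hs hs' hsD => ?_, fun s hs => ?_⟩, le_rfl⟩
      · rcases eq_or_lt_of_le hs with rfl | hs
        · exact absurd hsD hv
        · exact hD.done s hs hs' hsD
      · rcases hD.todo s (by omega) with h1 | h1 | h1 | ⟨s', hs', h1, h2⟩
        · exact .inl h1
        · exact .inr (.inl h1)
        · exact .inr (.inr (.inl h1))
        · rcases Nat.lt_succ_iff_lt_or_eq.1 hs' with hs' | rfl
          · exact .inr (.inr (.inr ⟨s', hs', h1, h2⟩))
          · exact absurd h2 hv
  simp only [hM, if_false]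
  -- A child of `ord m` would come later in the order, so only the vertex itself or its parent can
  -- dominate it.
  have hor : ord m ∈ D ∨ par (ord m) ∈ D := by
    rcases hD.todo m (by omega) with h1 | h1 | h1 | ⟨s', hs', h1, h2⟩
    · exact absurd h1 hM
    · exact .inl h1
    · exact .inr h1
    · rcases Nat.lt_succ_iff_lt_or_eq.1 hs' with hs' | rfl
      · exact absurd h1 (h.par_ne hs' hm)
      · exact .inl h2
  rcases Nat.eq_zero_or_pos m with rfl | h0
  · rw [h.root] at hor ⊢
    have hv : ord 0 ∈ D := hor.elim id id
    refine ⟨D, ⟨Finset.insert_subset hv hD.sub, fun s hs hs' hsD => ?_, fun s hs => by omega⟩,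
      le_rfl⟩
    rcases Nat.eq_zero_or_pos s with rfl | h0
    · exact Finset.mem_insert_self _ _
    · exact Finset.mem_insert_of_mem (hD.done s (by omega) hs' hsD)
  · have hE := hD.exchange h hm h0 hI
    refine ⟨_, ⟨Finset.insert_subset (Finset.mem_insert_self _ _) hE.sub,
      fun s hs hs' hsD => Finset.mem_insert_of_mem (hE.done s hs hs' hsD), hE.todo⟩, ?_⟩
    by_cases hv : ord m ∈ D
    · exact hcard _ hv
    · rw [Finset.erase_eq_of_notMem hv, Finset.insert_eq_of_mem (hor.resolve_left hv)]

end IsResidual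

/-- Every vertex of `T` lies in `I` or has a neighbour in `I`. -/
def Dominated (H : SimpleGraph ℕ) (I T : Finset ℕ) : Prop :=
  ∀ v ∈ T, v ∈ I ∨ ∃ w ∈ I, H.Adj v w

theorem Dominated.mono_left {H : SimpleGraph ℕ} {I I' T : Finset ℕ} (h : Dominated H I T)
    (hI : I ⊆ I') : Dominated H I' T := fun v hv =>
  (h v hv).imp (fun h => hI h) fun ⟨w, hw, ha⟩ => ⟨w, hI hw, ha⟩

/-- The state of the greedy algorithm, started with `I₀` and `M₀`, when `m` vertices remain. -/
structure IsGreedyState (H : SimpleGraph ℕ) (S : Finset ℕ) (cnt : ℕ) (ord par : ℕ → ℕ)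
    (I₀ M₀ : Finset ℕ) (m : ℕ) (I M : Finset ℕ) : Prop where
  sub : I ⊆ S
  dom : Dominated H I M
  done : ∀ s, m ≤ s → s < cnt → ord s ∈ I ∨ ∃ w ∈ I, H.Adj (ord s) w
  opt : ∀ D, IsResidual cnt ord par cnt I₀ M₀ D →
    ∃ D', IsResidual cnt ord par m I M D' ∧ D'.card ≤ D.card

namespace IsGreedyState

variable {H : SimpleGraph ℕ} {S : Finset ℕ} {cnt : ℕ} {ord par : ℕ → ℕ} {m : ℕ}
  {I₀ M₀ I M : Finset ℕ}

theorem start (hI : I₀ ⊆ S) (hM : Dominated H I₀ M₀) :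
    IsGreedyState H S cnt ord par I₀ M₀ cnt I₀ M₀ :=
  ⟨hI, hM, fun s hs hs' => by omega, fun D hD => ⟨D, hD, le_rfl⟩⟩

theorem step (h : IsTreeOrder H S cnt ord par) (hm : m < cnt)
    (hg : IsGreedyState H S cnt ord par I₀ M₀ (m + 1) I M) :
    IsGreedyState H S cnt ord par I₀ M₀ m (greedyIn (ord m) (par (ord m)) I M)
      (greedyDom (ord m) (par (ord m)) I M) := by
  have hII : I ⊆ greedyIn (ord m) (par (ord m)) I M := by
    unfold greedyIn
    split_ifs <;> simp
  have hpar := h.par_eq_or_adj (h.mem m hm)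
  refine ⟨?_, ?_, fun s hs hs' => ?_, fun D hD => ?_⟩
  · unfold greedyIn
    split_ifs
    · exact hg.sub
    · exact hg.sub
    · exact Finset.insert_subset (h.par_mem (h.mem m hm)) hg.sub
  · intro v hv
    unfold greedyDom at hv
    split_ifs at hv with hI
    · rcases Finset.mem_insert.1 hv with rfl | hv
      · rcases hpar with e | e
        · exact .inl (hII (by rwa [e]))
        · exact .inr ⟨_, hII hI, e.symm⟩
      · exact (hg.dom.mono_left hII) v hv
    · exact (hg.dom.mono_left hII) v hv
  · rcases eq_or_lt_of_le hs with rfl | hs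
    · by_cases hI : ord m ∈ I
      · exact .inl (hII hI)
      · by_cases hM : ord m ∈ M
        · exact (hg.dom.mono_left hII) _ hM
        · have : par (ord m) ∈ greedyIn (ord m) (par (ord m)) I M := by
            simp [greedyIn, hI, hM]
          rcases hpar with e | e
          · exact .inl (e.subst (motive := (· ∈ greedyIn (ord m) (par (ord m)) I M)) this)
          · exact .inr ⟨_, this, e⟩
    · exact (hg.done s hs hs').imp (fun h => hII h) fun ⟨w, hw, ha⟩ => ⟨w, hII hw, ha⟩
  · obtain ⟨D', h1, h2⟩ := hg.opt D hD
    obtain ⟨D'', h3, h4⟩ := h1.step h hm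
    exact ⟨D'', h3, h4.trans h2⟩

theorem dominated (h : IsTreeOrder H S cnt ord par)
    (hg : IsGreedyState H S cnt ord par I₀ M₀ 0 I M) : Dominated H I S := fun v hv => by
  obtain ⟨t, ht, rfl⟩ := h.surj v hv
  exact hg.done t (by omega) ht

/-- With no vertex left to treat, a residual solution still contains `I`, which bounds its size from
below. -/
theorem card_le (hg : IsGreedyState H S cnt ord par I₀ M₀ 0 I M) {D : Finset ℕ}
    (hD : IsResidual cnt ord par cnt I₀ M₀ D) : I.card ≤ D.card := by
  obtain ⟨D', h1, h2⟩ := hg.opt D hD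
  exact (Finset.card_le_card h1.sub).trans h2

end IsGreedyState

/-! ## Guesses -/

/-- A guess `δ` for the items `(u t, v t)`, `t < k`: with `δ t = 1` the vertex `u t` is chosen, and
with `δ t ≥ 2` the vertex `v t`. -/
def guessSet (u v δ : ℕ → ℕ) (k : ℕ) : Finset ℕ :=
  ((Finset.range k).filter fun t => δ t ≠ 0).image fun t => if δ t = 1 then u t else v t

theorem mem_guessSet {u v δ : ℕ → ℕ} {k w : ℕ} :
    w ∈ guessSet u v δ k ↔ ∃ t < k, δ t ≠ 0 ∧ (if δ t = 1 then u t else v t) = w := by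
  simp [guessSet, and_assoc]

theorem guessSet_zero (u v δ : ℕ → ℕ) : guessSet u v δ 0 = ∅ := by simp [guessSet]

theorem guessSet_succ (u v δ : ℕ → ℕ) (k : ℕ) : guessSet u v δ (k + 1) =
    if δ k = 0 then guessSet u v δ k else
      insert (if δ k = 1 then u k else v k) (guessSet u v δ k) := by
  unfold guessSet
  rw [Finset.range_add_one, Finset.filter_insert]
  split_ifs <;> simp_all

/-- The items `(u t, v t)`, `t < k`, with the guesses from `{0, …, b - 1}`, suffice to reduce
minimum domination on `S` to the tree. -/
structure IsGuessSystem (H : SimpleGraph ℕ) (S : Finset ℕ) (cnt : ℕ) (ord par : ℕ → ℕ)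
    (b k : ℕ) (u v : ℕ → ℕ) : Prop where
  two_le : 2 ≤ b
  mem : ∀ t < k, u t ∈ S ∧ v t ∈ S
  complete : ∀ D ⊆ S, Dominated H D S → ∃ δ : ℕ → ℕ, (∀ t < k, δ t < b) ∧
    guessSet u v δ k ⊆ D ∧ ∀ M : Finset ℕ,
      (∀ x ∈ S, ∀ y ∈ guessSet u v δ k, H.Adj x y → x ∈ M) →
      IsResidual cnt ord par cnt (guessSet u v δ k) M D

/-- The pair `(i, j)` is an edge inside `S` that is not an edge of the tree. -/
def IsNonTreeEdge (H : SimpleGraph ℕ) (S : Finset ℕ) (par : ℕ → ℕ) (i j : ℕ) : Prop :=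
  H.Adj i j ∧ i ∈ S ∧ j ∈ S ∧ j < i ∧ par i ≠ j ∧ par j ≠ i

/-- The right guess picks the end in `D` of each non-tree edge with exactly one end there, and
nothing for the other edges. If `x ∉ D` has a neighbour `w ∈ D`, then either `xw` is a tree edge,
which `IsResidual` allows, or it is listed with only `w` in `D`, so that `w` is guessed and `x` is
marked. -/
theorem IsGuessSystem.of_edges {H : SimpleGraph ℕ} {S : Finset ℕ} {cnt : ℕ} {ord par : ℕ → ℕ}
    (h : IsTreeOrder H S cnt ord par) {k : ℕ} {u v : ℕ → ℕ}
    (hmem : ∀ t < k, IsNonTreeEdge H S par (u t) (v t))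
    (hall : ∀ i j, IsNonTreeEdge H S par i j → ∃ t < k, u t = i ∧ v t = j) :
    IsGuessSystem H S cnt ord par 3 k u v := by
  classical
  refine ⟨by norm_num, fun t ht => ⟨(hmem t ht).2.1, (hmem t ht).2.2.1⟩, fun D hD hdom => ?_⟩
  let δ : ℕ → ℕ := fun t =>
    if u t ∈ D then (if v t ∈ D then 0 else 1) else (if v t ∈ D then 2 else 0)
  have hsub : guessSet u v δ k ⊆ D := by
    intro w hw
    obtain ⟨t, ht, h0, h1⟩ := mem_guessSet.1 hw
    by_cases hu : u t ∈ D <;> by_cases hv : v t ∈ D <;> simp [δ, hu, hv] at h0 h1 <;>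
      (rw [← h1]; assumption)
  refine ⟨δ, fun t ht => by dsimp only [δ]; split_ifs <;> norm_num, hsub, fun M hM =>
    ⟨hsub, fun s hs hs' => by omega, fun s hs => ?_⟩⟩
  by_cases hx : ord s ∈ D
  · exact .inr (.inl hx)
  obtain ⟨w, hw, ha⟩ := (hdom _ (h.mem s hs)).resolve_left hx
  by_cases h1 : par (ord s) = w
  · exact .inr (.inr (.inl (h1 ▸ hw)))
  by_cases h2 : par w = ord s
  · obtain ⟨s', hs', rfl⟩ := h.surj w (hD hw)
    exact .inr (.inr (.inr ⟨s', hs', h2, hw⟩))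
  refine .inl (hM _ (h.mem s hs) w (mem_guessSet.2 ?_) ha)
  rcases lt_or_gt_of_ne ha.ne with hlt | hlt
  · obtain ⟨t, ht, e1, e2⟩ := hall w (ord s) ⟨ha.symm, hD hw, h.mem s hs, hlt, h2, h1⟩
    exact ⟨t, ht, by simp [δ, e1, e2, hx, hw]⟩
  · obtain ⟨t, ht, e1, e2⟩ := hall (ord s) w ⟨ha, h.mem s hs, hD hw, hlt, h1, h2⟩
    exact ⟨t, ht, by simp [δ, e1, e2, hx, hw]⟩

/-- Here the guess is all of `D`, and every vertex is chosen or marked. Base `2` leaves only the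
digits `0` and `1`, so the second component of an item plays no role. -/
theorem IsGuessSystem.of_vertices {H : SimpleGraph ℕ} {S : Finset ℕ} {cnt : ℕ} {ord par : ℕ → ℕ}
    (h : IsTreeOrder H S cnt ord par) {u v : ℕ → ℕ} (hu : ∀ t < cnt, u t = ord t)
    (hv : ∀ t < cnt, v t = ord t) : IsGuessSystem H S cnt ord par 2 cnt u v := by
  classical
  refine ⟨le_rfl, fun t ht => by rw [hu t ht, hv t ht]; exact ⟨h.mem t ht, h.mem t ht⟩,
    fun D hD hdom => ?_⟩
  let δ : ℕ → ℕ := fun t => if ord t ∈ D then 1 else 0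
  have heq : guessSet u v δ cnt = D := by
    ext w
    rw [mem_guessSet]
    constructor
    · rintro ⟨t, ht, h0, h1⟩
      by_cases hd : ord t ∈ D
      · simp only [δ, hd, if_true, hu t ht] at h1
        exact h1 ▸ hd
      · simp [δ, hd] at h0
    · intro hw
      obtain ⟨t, ht, rfl⟩ := h.surj w (hD hw)
      exact ⟨t, ht, by simp [δ, hw, hu t ht]⟩
  refine ⟨δ, fun t ht => by dsimp only [δ]; split_ifs <;> norm_num, heq.subset, fun M hM => ?_⟩
  rw [heq] at hM ⊢
  refine ⟨subset_rfl, fun s hs hs' => by omega, fun s hs => ?_⟩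
  rcases hdom _ (h.mem s hs) with hx | ⟨w, hw, ha⟩
  · exact .inr (.inl hx)
  · exact .inl (hM _ (h.mem s hs) w hw ha)

/-- Lets a single counter below `b ^ k` run through all guesses. -/
theorem exists_digits {b : ℕ} (hb : 2 ≤ b) (δ : ℕ → ℕ) (k : ℕ) (hδ : ∀ t < k, δ t < b) :
    ∃ c < b ^ k, ∀ t < k, c / b ^ t % b = δ t := by
  induction k with
  | zero => exact ⟨0, by simp⟩
  | succ k ih =>
    obtain ⟨c, hc, h⟩ := ih fun t ht => hδ t (by omega)
    refine ⟨c + b ^ k * δ k, ?_, fun t ht => ?_⟩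
    · have := hδ k (by omega)
      rw [pow_succ]
      nlinarith [Nat.mul_le_mul_left (b ^ k) (Nat.succ_le_of_lt this)]
    · rcases Nat.lt_succ_iff_lt_or_eq.1 ht with ht | rfl
      · rw [← h t ht]
        obtain ⟨d, rfl⟩ : ∃ d, k = t + 1 + d := ⟨k - (t + 1), by omega⟩
        rw [show b ^ (t + 1 + d) * δ (t + 1 + d) = b ^ t * (b * (b ^ d * δ (t + 1 + d))) by ring,
          Nat.add_mul_div_left _ _ (by positivity), Nat.add_mul_mod_self_left]
      · rw [Nat.add_mul_div_left _ _ (by positivity), Nat.div_eq_of_lt hc, zero_add,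
          Nat.mod_eq_of_lt (hδ _ (by omega))]

/-! ## Counting -/

/-- The edges of a graph inside a set of vertices. -/
def edgesIn {V : Type*} (G : SimpleGraph V) (W : Set V) : Set (Sym2 V) :=
  {e ∈ G.edgeSet | ∀ x ∈ e, x ∈ W}

/-- The `k` listed edges and the `cnt - 1` edges from non-root vertices to their parents are
pairwise different edges inside `S`. -/
theorem IsTreeOrder.card_nonTreeEdges_add_le {H : SimpleGraph ℕ} {S : Finset ℕ} {cnt : ℕ}
    {ord par : ℕ → ℕ} (h : IsTreeOrder H S cnt ord par) {k : ℕ} {u v : ℕ → ℕ}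
    (hmem : ∀ t < k, IsNonTreeEdge H S par (u t) (v t))
    (hinj : ∀ s < k, ∀ t < k, u s = u t → v s = v t → s = t)
    (hfin : (edgesIn H S).Finite) : k + cnt ≤ (edgesIn H S).ncard + 1 := by
  classical
  set A := (Finset.range k).image fun t => s(u t, v t)
  set B := (Finset.Ico 1 cnt).image fun t => s(ord t, par (ord t))
  have hA : A.card = k := by
    rw [Finset.card_image_of_injOn, Finset.card_range]
    intro s hs t ht hst
    simp only [Finset.coe_range, Set.mem_Iio] at hs ht
    have hs' := (hmem s hs).2.2.2.1
    have ht' := (hmem t ht).2.2.2.1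
    rcases Sym2.eq_iff.1 hst with ⟨e1, e2⟩ | ⟨e1, e2⟩
    · exact hinj s hs t ht e1 e2
    · omega
  have hB : B.card = cnt - 1 := by
    rw [Finset.card_image_of_injOn, Nat.card_Ico]
    intro s hs t ht hst
    simp only [Finset.coe_Ico, Set.mem_Ico] at hs ht
    obtain ⟨s', hs', es, -⟩ := h.par s hs.1 hs.2
    obtain ⟨t', ht', et, -⟩ := h.par t ht.1 ht.2
    simp only [es, et] at hst
    rcases Sym2.eq_iff.1 hst with ⟨e1, e2⟩ | ⟨e1, e2⟩
    · exact h.inj s hs.2 t ht.2 e1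
    -- If the ends were swapped, each of the two vertices would be the parent of the other and so
    -- precede it.
    · have h1 := h.inj s hs.2 t' (by omega) e1
      have h2 := h.inj s' (by omega) t ht.2 e2
      omega
  have hdisj : Disjoint A B := by
    rw [Finset.disjoint_left]
    intro e he he'
    obtain ⟨t, ht, rfl⟩ := Finset.mem_image.1 he
    obtain ⟨s, hs, e⟩ := Finset.mem_image.1 he'
    obtain ⟨-, -, -, -, h1, h2⟩ := hmem t (by simpa using ht)
    rcases Sym2.eq_iff.1 e with ⟨e1, e2⟩ | ⟨e1, e2⟩
    · exact h1 (by rw [← e1, e2])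
    · exact h2 (by rw [← e1, e2])
  have hsub : (↑(A ∪ B) : Set (Sym2 ℕ)) ⊆ edgesIn H S := by
    intro e he
    simp only [Finset.coe_union, Set.mem_union, Finset.mem_coe] at he
    rcases he with he | he
    · obtain ⟨t, ht, rfl⟩ := Finset.mem_image.1 he
      obtain ⟨h1, h2, h3, -⟩ := hmem t (by simpa using ht)
      exact ⟨h1, by simp [h2, h3]⟩
    · obtain ⟨t, ht, rfl⟩ := Finset.mem_image.1 he
      simp only [Finset.mem_Ico] at ht
      obtain ⟨s, hs, es, ha⟩ := h.par t ht.1 ht.2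
      rw [es]
      exact ⟨ha, by simp [h.mem t ht.2, h.mem s (by omega)]⟩
  have := Set.ncard_le_ncard hsub hfin
  rw [Set.ncard_coe_finset, Finset.card_union_of_disjoint hdisj, hA, hB] at this
  omega

/-- A weighted geometric mean with weights `3/5` and `2/5`, chosen so that `3 ^ 3 = 27 ≤ 32 = 2 ^
5`. -/
theorem min_pow_five_le (f c : ℕ) : (min (3 ^ f) (2 ^ c)) ^ 5 ≤ 2 ^ (5 * f + 2 * c) := by
  calc (min (3 ^ f) (2 ^ c)) ^ 5 = (min (3 ^ f) (2 ^ c)) ^ 3 * (min (3 ^ f) (2 ^ c)) ^ 2 := by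
        rw [← pow_add]
    _ ≤ (3 ^ f) ^ 3 * (2 ^ c) ^ 2 :=
        Nat.mul_le_mul (Nat.pow_le_pow_left (min_le_left _ _) _)
          (Nat.pow_le_pow_left (min_le_right _ _) _)
    _ = 27 ^ f * 2 ^ (2 * c) := by
        rw [← pow_mul 3, mul_comm f 3, pow_mul 3, ← pow_mul 2, mul_comm c 2]
        norm_num
    _ ≤ 32 ^ f * 2 ^ (2 * c) := Nat.mul_le_mul_right _ (Nat.pow_le_pow_left (by norm_num) _)
    _ = 2 ^ (5 * f + 2 * c) := by
        rw [pow_add, pow_mul 2 5]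
        norm_num

/-! ## The degree-one reduction -/

/-- Every proper nonempty part of `W` is joined to the rest of `W` by an edge. -/
def IsCutConnected {V : Type*} (G : SimpleGraph V) (W : Set V) : Prop :=
  ∀ S ⊆ W, S.Nonempty → S ≠ W → ∃ i ∈ S, ∃ j ∈ W \ S, G.Adj i j

theorem SimpleGraph.Connected.isCutConnected {V : Type*} {G : SimpleGraph V} (h : G.Connected) :
    IsCutConnected G Set.univ := by
  intro S _ hne hS
  obtain ⟨a, ha⟩ := hne
  obtain ⟨b, hb⟩ := (Set.ne_univ_iff_exists_notMem S).1 hS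
  obtain ⟨w⟩ := h.preconnected a b
  obtain ⟨d, -, h1, h2⟩ := w.exists_boundary_dart S ha hb
  exact ⟨_, h1, _, ⟨trivial, h2⟩, d.adj⟩

/-- The deleted vertex `v` has a single neighbour `u` in `W`. -/
theorem SimpleGraph.DeletesDegreeOne.exists_neighbor {V : Type*} {G : SimpleGraph V}
    {W W' : Set V} (h : G.DeletesDegreeOne W W') :
    ∃ v ∈ W, ∃ u ∈ W, W' = W \ {v} ∧ G.Adj v u ∧ ∀ x ∈ W, G.Adj v x → x = u := by
  obtain ⟨⟨v, hv⟩, h1, rfl⟩ := h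
  obtain ⟨⟨u, hu⟩, h2⟩ := Set.encard_eq_one.1 h1
  refine ⟨v, hv, u, hu, rfl, ?_, fun x hx ha => ?_⟩
  · have : (⟨u, hu⟩ : W) ∈ (G.induce W).neighborSet ⟨v, hv⟩ := h2 ▸ rfl
    simpa using this
  · have : (⟨x, hx⟩ : W) ∈ (G.induce W).neighborSet ⟨v, hv⟩ := by simpa using ha
    rw [h2] at this
    simpa using this

/-- Put the deleted vertex on the side of its only neighbour: an edge across the resulting cut of
`W` cannot meet the deleted vertex. -/
theorem IsCutConnected.deletesDegreeOne {V : Type*} {G : SimpleGraph V} {W W' : Set V}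
    (h : IsCutConnected G W) (hd : G.DeletesDegreeOne W W') : IsCutConnected G W' := by
  obtain ⟨v, hv, u, hu, rfl, hvu, huniq⟩ := hd.exists_neighbor
  intro S hS hne hS'
  have hvS : v ∉ S := fun hm => (hS hm).2 rfl
  by_cases huS : u ∈ S
  · obtain ⟨i, hi, j, ⟨hj, hj'⟩, ha⟩ := h (insert v S)
      (Set.insert_subset hv (hS.trans Set.sdiff_subset)) (Set.insert_nonempty _ _) (fun e => hS' (by
        rw [← e, Set.insert_sdiff_of_mem _ (Set.mem_singleton v)]
        exact (Set.sdiff_singleton_eq_self hvS).symm))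
    rw [Set.mem_insert_iff, not_or] at hj'
    rcases hi with rfl | hi
    · exact absurd huS (huniq j hj ha ▸ hj'.2)
    · exact ⟨i, hi, j, ⟨⟨hj, hj'.1⟩, hj'.2⟩, ha⟩
  · obtain ⟨i, hi, j, ⟨hj, hj'⟩, ha⟩ := h S (hS.trans Set.sdiff_subset) hne
      (fun e => hvS (e ▸ hv))
    refine ⟨i, hi, j, ⟨⟨hj, fun e => ?_⟩, hj'⟩, ha⟩
    rw [Set.mem_singleton_iff] at e
    subst e
    exact huS (huniq i (hS hi).1 ha.symm ▸ hi)

section Fin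

variable {n : ℕ} {G : SimpleGraph (Fin n)} {U W : Set (Fin n)}

theorem reduction_isCutConnected (hG : G.Connected)
    (h : Relation.ReflTransGen G.DeletesDegreeOne Set.univ W) : IsCutConnected G W := by
  induction h with
  | refl => exact hG.isCutConnected
  | tail _ h ih => exact ih.deletesDegreeOne h

/-- Each deletion removes one vertex and at least the edge to its neighbour, so edges minus vertices
does not grow. -/
theorem reduction_card (h : Relation.ReflTransGen G.DeletesDegreeOne Set.univ W) :
    (edgesIn G W).ncard + n ≤ G.edgeSet.ncard + W.ncard := by
  induction h with
  | refl => simp [edgesIn]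
  | @tail W W' _ h ih =>
    obtain ⟨v, hv, u, hu, rfl, hvu, huniq⟩ := h.exists_neighbor
    have h1 : (edgesIn G (W \ {v})).ncard + 1 ≤ (edgesIn G W).ncard := by
      have hlt : edgesIn G (W \ {v}) ⊂ edgesIn G W := by
        refine ⟨fun e he => ⟨he.1, fun x hx => (he.2 x hx).1⟩, fun hsub => ?_⟩
        have := hsub (show s(v, u) ∈ edgesIn G W from ⟨hvu, by simp [hv, hu]⟩)
        exact (this.2 v (by simp)).2 rfl
      exact Set.ncard_lt_ncard hlt (Set.toFinite _)
    have h2 := Set.ncard_sdiff_singleton_add_one hv (Set.toFinite W)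
    omega

/-- Connectivity supplies one neighbour, and degree different from one a second. -/
theorem IsCutConnected.exists_two_neighbors (h : IsCutConnected G U)
    (hU : ∀ v : U, ((G.induce U).neighborSet v).encard ≠ 1) (h2 : 2 ≤ U.ncard) {v : Fin n}
    (hv : v ∈ U) : ∃ x ∈ U, ∃ y ∈ U, x ≠ y ∧ G.Adj v x ∧ G.Adj v y := by
  obtain ⟨i, hi, x, ⟨hx, -⟩, ha⟩ := h {v} (by simpa using hv) (by simp) (fun e => by
    rw [← e, Set.ncard_singleton] at h2
    omega)
  rw [Set.mem_singleton_iff] at hi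
  subst hi
  by_contra! hcon
  refine hU ⟨i, hv⟩ (Set.encard_eq_one.2 ⟨⟨x, hx⟩, ?_⟩)
  ext ⟨y, hy⟩
  simp only [SimpleGraph.mem_neighborSet, SimpleGraph.comap_adj, Function.Embedding.subtype_apply,
    Set.mem_singleton_iff, Subtype.mk.injEq]
  constructor
  · intro hay
    by_contra hne
    exact hcon x hx y hy (Ne.symm hne) ha hay
  · rintro rfl
    exact ha

/-- As long as all of `U` is present, each vertex of `U` has two neighbours, so no deletion can be
the first to hit `U`. -/
theorem IsCutConnected.subset_reduction (h : IsCutConnected G U)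
    (hU : ∀ v : U, ((G.induce U).neighborSet v).encard ≠ 1) (h2 : 2 ≤ U.ncard)
    (hW : Relation.ReflTransGen G.DeletesDegreeOne Set.univ W) : U ⊆ W := by
  induction hW with
  | refl => exact Set.subset_univ _
  | tail _ hd ih =>
    obtain ⟨v, hv, u, hu, rfl, hvu, huniq⟩ := hd.exists_neighbor
    refine fun x hx => ⟨ih hx, fun e => ?_⟩
    rw [Set.mem_singleton_iff] at e
    subst e
    obtain ⟨y, hy, z, hz, hyz, h1, h2⟩ := h.exists_two_neighbors hU h2 hx
    exact hyz ((huniq y (ih hy) h1).trans (huniq z (ih hz) h2).symm)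

/-- If few vertices are deleted, the reduction of a connected graph is unique. -/
theorem reduction_unique (hG : G.Connected) (hU : G.IsDegreeOneReduction U)
    (hW : G.IsDegreeOneReduction W) (hcard : 5 * Uᶜ.ncard ≤ n) : W = U := by
  have hadd := Set.ncard_add_ncard_compl U
  rw [Nat.card_eq_fintype_card, Fintype.card_fin] at hadd
  by_cases h2 : 2 ≤ U.ncard
  · have h1 := (reduction_isCutConnected hG hU.1).subset_reduction hU.2 h2 hW.1
    refine subset_antisymm ?_ h1
    exact (reduction_isCutConnected hG hW.1).subset_reduction hW.2
      (h2.trans (Set.ncard_le_ncard h1 (Set.toFinite _))) hU.1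
  -- From `|U| ≤ 1` and `5 * (n - |U|) ≤ n`. With at most one vertex there is no edge and nothing
  -- can be deleted.
  · have hn : n ≤ 1 := by omega
    have key : ∀ {X : Set (Fin n)},
        Relation.ReflTransGen G.DeletesDegreeOne Set.univ X → X = Set.univ := by
      intro X hX
      rcases hX.cases_head with e | ⟨Y, hY, -⟩
      · exact e.symm
      · obtain ⟨v, -, u, -, -, hvu, -⟩ := hY.exists_neighbor
        exact absurd (Fin.ext (by omega)) hvu.ne
    rw [key hU.1, key hW.1]

end Fin

/-! ### The degree-one reduction on the machine -/

namespace RAM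

/-- The constants of the main program: `n` in register `0`, `1` in register `1`, `n * n` in
register `2`, `0` in register `9`, and the adjacency matrix of `H` in array `0`. -/
structure Ctx (n : ℕ) (H : SimpleGraph ℕ) [DecidableRel H.Adj] (s : State) : Prop where
  reg0 : s.reg 0 = n
  reg1 : s.reg 1 = 1
  reg2 : s.reg 2 = n * n
  reg9 : s.reg 9 = 0
  adj : ∀ e < n * n, s.arr (0, e) = if H.Adj (e / n) (e % n) then 1 else 0

/-- Array `2` marks the vertices outside `W`. -/
def MarksDead (n : ℕ) (W : Finset ℕ) (s : State) : Prop :=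
  ∀ v < n, s.arr (2, v) = if v ∈ W then 0 else 1

section

variable {n N : ℕ} {H : SimpleGraph ℕ} [DecidableRel H.Adj] {s s' : State} {W : Finset ℕ}

theorem Ctx.sameOff {R K : List ℕ} (h : Ctx n H s) (hs : SameOff R K s s')
    (hR : 0 ∉ R ∧ 1 ∉ R ∧ 2 ∉ R ∧ 9 ∉ R := by decide) (hK : 0 ∉ K := by decide) :
    Ctx n H s' :=
  ⟨(hs.reg 0 hR.1).trans h.reg0, (hs.reg 1 hR.2.1).trans h.reg1, (hs.reg 2 hR.2.2.1).trans h.reg2,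
    (hs.reg 9 hR.2.2.2).trans h.reg9, fun e he => (hs.arr 0 hK e).trans (h.adj e he)⟩

theorem Ctx.setReg (h : Ctx n H s) {d v : ℕ}
    (hd : d ≠ 0 ∧ d ≠ 1 ∧ d ≠ 2 ∧ d ≠ 9 := by decide) : Ctx n H (s.setReg d v) := by
  obtain ⟨h0, h1, h2, h9⟩ := hd
  obtain ⟨k0, k1, k2, k9, ka⟩ := h
  exact ⟨by simp [h0.symm, k0], by simp [h1.symm, k1], by simp [h2.symm, k2], by simp [h9.symm, k9],
    ka⟩

theorem Ctx.setArr (h : Ctx n H s) {k i v : ℕ} (hk : k ≠ 0 := by decide) :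
    Ctx n H (s.setArr k i v) := by
  obtain ⟨k0, k1, k2, k9, ka⟩ := h
  exact ⟨k0, k1, k2, k9, fun e he => by simpa [hk.symm] using ka e he⟩

theorem MarksDead.sameOff {R K : List ℕ} (h : MarksDead n W s) (hs : SameOff R K s s')
    (hK : 2 ∉ K := by decide) : MarksDead n W s' :=
  fun v hv => (hs.arr 2 hK v).trans (h v hv)

theorem lt_four_pow_of_le {x : ℕ} (h : x ≤ N) : x < 4 ^ N :=
  h.trans_lt (Nat.lt_pow_self (by norm_num))

theorem mul_add_lt_sq {i j : ℕ} (hi : i < n) (hj : j < n) : i * n + j < n * n := by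
  nlinarith [Nat.mul_le_mul_right n (Nat.succ_le_of_lt hi)]

theorem mul_add_div_mod (i : ℕ) {j : ℕ} (hj : j < n) :
    (i * n + j) / n = i ∧ (i * n + j) % n = j := by
  rw [mul_comm, Nat.mul_add_div (by omega), Nat.div_eq_of_lt hj, add_zero, Nat.mul_add_mod,
    Nat.mod_eq_of_lt hj]
  exact ⟨rfl, rfl⟩

/-- Do nothing (but clear the scratch register `19`). -/
def skip : Prog := .instr (.const 19 0)

theorem wp_skip {Q : State → Prop} (hs : Bounded N s) (h : Q (s.setReg 19 0)) :
    WP N skip s Q :=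
  WP.const hs (by decide) (by positivity) fun _ => h

/-- Count in register `10` the neighbours in `W` of the vertex in register `22`. -/
def countNeighbors : Prog :=
  .instr (.const 10 0) ⨟ .instr (.op .mul 13 22 0) ⨟ forLoop 24 0
    (.instr (.op .add 11 13 24) ⨟ .instr (.load 11 0 11) ⨟ .instr (.load 12 2 24) ⨟
      .instr (.op .sub 11 11 12) ⨟ .instr (.op .add 10 10 11))

theorem wp_countNeighbors (hs : Bounded N s) (hN : n * n + n + 4 ≤ N) (hc : Ctx n H s)
    (hd : MarksDead n W s) {i : ℕ} (hi : i < n) (h22 : s.reg 22 = i) :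
    WP N countNeighbors s fun s' =>
      s'.reg 10 = ((Finset.range n).filter fun x => x ∈ W ∧ H.Adj i x).card := by
  have hin : i * n ≤ n * n := Nat.mul_le_mul_right n hi.le
  refine WP.seq' (WP.const hs (by decide) (by positivity) fun hs₁ => ?_)
  refine WP.seq' (WP.mul hs₁ (v := i * n) (by simp [h22, hc.reg0])
    (lt_four_pow_of_le (by omega)) fun hs₂ => ?_)
  refine WP.forLoop (M := n) (I := fun j s' => s'.reg 10 =
      ((Finset.range j).filter fun x => x ∈ W ∧ H.Adj i x).card) hs₂ (by simp [hc.reg0])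
    (by omega) (by simp [hc.reg1]) (by decide) (by intros; simpa) (by simp) ?_
  intro j s₃ hj hs₃ hsame h24 hI
  have h13 : s₃.reg 13 = i * n := by
    rw [hsame.reg 13 (by decide)]; simp
  have hc₃ : Ctx n H s₃ := hc.setReg.setReg.sameOff hsame
  have hd₃ : MarksDead n W s₃ := fun v hv => (hsame.arr 2 (by decide) v).trans (hd v hv)
  have hij := mul_add_lt_sq hi hj
  refine WP.seq' (WP.add hs₃ (v := i * n + j) (by rw [h13, h24])
    (lt_four_pow_of_le (by omega)) fun hs₄ => ?_)
  refine WP.seq' (WP.load hs₄ (v := if H.Adj i j then 1 else 0) ?_ fun hs₅ => ?_)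
  · have h1 : (i * n + j) / n = i := by
      rw [mul_comm, Nat.mul_add_div (by omega), Nat.div_eq_of_lt hj, add_zero]
    have h2 : (i * n + j) % n = j := by
      rw [mul_comm, Nat.mul_add_mod, Nat.mod_eq_of_lt hj]
    have := hc₃.adj _ hij
    rw [h1, h2] at this
    simpa using this
  refine WP.seq' (WP.load hs₅ (v := if j ∈ W then 0 else 1) (by simpa [h24] using hd₃ j hj)
    fun hs₆ => ?_)
  -- On the values `0` and `1`, truncated subtraction is "and not"; the later tests use the same
  -- device, with products for "and".
  refine WP.seq' (WP.sub hs₆ (v := if j ∈ W ∧ H.Adj i j then 1 else 0) ?_ fun hs₇ => ?_)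
  · by_cases h1 : j ∈ W <;> by_cases h2 : H.Adj i j <;> simp [h1, h2]
  have hle : ((Finset.range (j + 1)).filter fun x => x ∈ W ∧ H.Adj i x).card ≤ j + 1 :=
    (Finset.card_filter_le _ _).trans_eq (Finset.card_range _)
  have hval : ((Finset.range j).filter fun x => x ∈ W ∧ H.Adj i x).card +
      (if j ∈ W ∧ H.Adj i j then 1 else 0) =
      ((Finset.range (j + 1)).filter fun x => x ∈ W ∧ H.Adj i x).card := by
    rw [Finset.range_add_one, Finset.filter_insert]
    split_ifs with h
    · rw [Finset.card_insert_of_notMem (by simp)]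
    · rfl
  refine WP.add hs₇ (v := ((Finset.range (j + 1)).filter fun x => x ∈ W ∧ H.Adj i x).card)
    (by simp [hI, hval]) (lt_four_pow_of_le (by omega)) fun hs₈ => by simp

/-- If the vertex in register `22` has exactly one neighbour in `W`, mark it as dead. -/
def deleteVertex : Prog :=
  countNeighbors ⨟ .instr (.op .div 10 1 10) ⨟ .ite 10 (.instr (.store 2 22 1)) skip

theorem wp_deleteVertex (hs : Bounded N s) (hN : n * n + n + 4 ≤ N) (hc : Ctx n H s)
    (hd : MarksDead n W s) {i : ℕ} (hi : i < n) (h22 : s.reg 22 = i) :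
    WP N deleteVertex s (MarksDead n
      (if ((Finset.range n).filter fun x => x ∈ W ∧ H.Adj i x).card = 1 then W.erase i else W)) := by
  refine WP.seq (wp_countNeighbors hs hN hc hd hi h22) fun s₁ hs₁ hsame h10 => ?_
  have hc₁ : Ctx n H s₁ := hc.sameOff hsame
  have hd₁ : MarksDead n W s₁ := hd.sameOff hsame
  have h22₁ : s₁.reg 22 = i := (hsame.reg 22 (by decide)).trans h22
  set k := ((Finset.range n).filter fun x => x ∈ W ∧ H.Adj i x).card
  -- The quotient `1 / k` is nonzero only for `k = 1`, by the convention `1 / 0 = 0`.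
  refine WP.seq' (WP.div hs₁ (v := if k = 1 then 1 else 0) ?_ fun hs₂ => ?_)
  · rw [hc₁.reg1, h10]
    rcases k with _ | _ | k
    · simp
    · simp
    · simp [Nat.div_eq_of_lt]
  refine WP.ite hs₂ (fun h => ?_) fun h => wp_skip hs₂ ?_
  · have hk : k = 1 := by simpa using h
    refine WP.store hs₂ (i := i) (v := 1) (by simpa using h22₁) (by simpa using hc₁.reg1) (by omega)
      fun _ v hv => ?_
    by_cases hvi : v = i
    · simp [hk, hvi]
    · simpa [hk, hvi] using hd₁ v hv
  · have hk : ¬ k = 1 := by simpa using h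
    intro v hv
    simpa [hk] using hd₁ v hv

/-- Repeatedly delete vertices of degree one. -/
def reduceGraph : Prog := forLoop 20 0 (forLoop 22 0 deleteVertex)

end

/-- The number of neighbours of `i` in `W`. -/
def degIn (n : ℕ) (H : SimpleGraph ℕ) [DecidableRel H.Adj] (W : Finset ℕ) (i : ℕ) : ℕ :=
  ((Finset.range n).filter fun x => x ∈ W ∧ H.Adj i x).card

/-- The vertices of a graph on `Fin n` with numbers in `W`. -/
def finPart (n : ℕ) (W : Finset ℕ) : Set (Fin n) := {v | (v : ℕ) ∈ W}

theorem map_val_adj_iff {n : ℕ} {G : SimpleGraph (Fin n)} {i j : Fin n} :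
    (G.map Fin.valEmbedding).Adj (i : ℕ) (j : ℕ) ↔ G.Adj i j :=
  SimpleGraph.map_adj_apply (f := Fin.valEmbedding)

section

variable {n N : ℕ} {G : SimpleGraph (Fin n)} [DecidableRel (G.map Fin.valEmbedding).Adj]
  {W : Finset ℕ}

theorem encard_neighborSet_finPart (v : finPart n W) :
    ((G.induce (finPart n W)).neighborSet v).encard =
      degIn n (G.map Fin.valEmbedding) W ((v : Fin n) : ℕ) := by
  have hinj : Function.Injective fun x : finPart n W => ((x : Fin n) : ℕ) :=
    Fin.val_injective.comp Subtype.val_injective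
  rw [degIn, ← Set.encard_coe_eq_coe_finsetCard, ← hinj.encard_image]
  congr 1
  ext x
  simp only [Set.mem_image, SimpleGraph.mem_neighborSet, SimpleGraph.comap_adj,
    Function.Embedding.subtype_apply, Finset.coe_filter, Finset.mem_range, Set.mem_ofPred_eq]
  constructor
  · rintro ⟨⟨y, hy⟩, h1, rfl⟩
    exact ⟨y.isLt, hy, map_val_adj_iff.2 h1⟩
  · rintro ⟨h1, h2, h3⟩
    exact ⟨⟨⟨x, h1⟩, h2⟩, map_val_adj_iff.1 h3, rfl⟩

theorem deletesDegreeOne_finPart (hW : W ⊆ Finset.range n) {i : ℕ} (hi : i ∈ W)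
    (h : degIn n (G.map Fin.valEmbedding) W i = 1) :
    G.DeletesDegreeOne (finPart n W) (finPart n (W.erase i)) := by
  refine ⟨⟨⟨i, by simpa using hW hi⟩, hi⟩, ?_, ?_⟩
  · rw [encard_neighborSet_finPart]
    simp [h]
  · ext x
    simp [finPart, Fin.ext_iff, and_comm]

/-- A sweep over all vertices either deletes one or shows that no vertex of degree one is left.
Since `n` effective sweeps would empty the graph, `n` sweeps suffice. -/
theorem wp_reduceGraph {s : State} (hs : Bounded N s) (hN : n * n + n + 4 ≤ N)
    (hc : Ctx n (G.map Fin.valEmbedding) s) (h2 : ∀ v, s.arr (2, v) = 0) :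
    WP N reduceGraph s fun s' => ∃ W ⊆ Finset.range n,
      G.IsDegreeOneReduction (finPart n W) ∧ MarksDead n W s' := by
  have hloop := WP.forLoop (r := 20) (M := n) (body := forLoop 22 0 deleteVertex)
    (I := fun t s' => ∃ W ⊆ Finset.range n,
      Relation.ReflTransGen G.DeletesDegreeOne Set.univ (finPart n W) ∧ MarksDead n W s' ∧
      ((∀ i ∈ W, degIn n (G.map Fin.valEmbedding) W i ≠ 1) ∨ W.card + t ≤ n)) hs hc.reg0
    (by omega) hc.reg1 (by decide) (fun _ _ _ _ h => h) ?_ ?_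
  · refine hloop.mono fun s' _ _ ⟨W, hW, h1, h2, h3⟩ => ⟨W, hW, ⟨h1, fun v => ?_⟩, h2⟩
    rw [encard_neighborSet_finPart]
    rcases h3 with h3 | h3
    · exact_mod_cast h3 v v.2
    · have hW0 : W = ∅ := Finset.card_eq_zero.1 (by omega)
      exact absurd v.2 (by simp [finPart, hW0])
  · refine ⟨Finset.range n, subset_rfl, ?_, fun v hv => by simp [hv, h2], by simp⟩
    have : finPart n (Finset.range n) = Set.univ := by
      ext x; simp [finPart]
    rw [this]
  · rintro t s₁ ht hs₁ hsame - ⟨W₀, hW₀, h1, h2, h3⟩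
    have hc₁ := hc.sameOff hsame
    refine (WP.forLoop (r := 22) (M := n) (body := deleteVertex) (I := fun i s' =>
      ∃ W ⊆ Finset.range n,
      Relation.ReflTransGen G.DeletesDegreeOne Set.univ (finPart n W) ∧ MarksDead n W s' ∧
      ((W = W₀ ∧ ∀ i' < i, i' ∈ W → degIn n (G.map Fin.valEmbedding) W i' ≠ 1) ∨
        W.card + (t + 1) ≤ n)) hs₁ hc₁.reg0
      (by omega) hc₁.reg1 (by decide) (fun _ _ _ _ h => h) ?_ ?_).mono ?_
    · exact ⟨W₀, hW₀, h1, h2, .inl ⟨rfl, by omega⟩⟩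
    · rintro i s₂ hi hs₂ hsame₂ h22 ⟨W, hW, k1, k2, k3⟩
      refine (wp_deleteVertex hs₂ hN (hc₁.sameOff hsame₂) k2 hi h22).mono fun s₃ _ _ k4 => ?_
      change MarksDead n
        (if degIn n (G.map Fin.valEmbedding) W i = 1 then W.erase i else W) s₃ at k4
      by_cases hdel : i ∈ W ∧ degIn n (G.map Fin.valEmbedding) W i = 1
      · rw [if_pos hdel.2] at k4
        refine ⟨W.erase i, (Finset.erase_subset _ _).trans hW,
          k1.tail (deletesDegreeOne_finPart hW hdel.1 hdel.2), k4, .inr ?_⟩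
        have hcard := Finset.card_erase_of_mem hdel.1
        have hpos := Finset.card_pos.2 ⟨i, hdel.1⟩
        rcases k3 with ⟨rfl, k3⟩ | k3
        · rcases h3 with h3 | h3
          · exact absurd hdel.2 (h3 i hdel.1)
          · omega
        · omega
      -- The program does not test whether `i` is still alive; marking a dead vertex again changes
      -- nothing.
      · have hsame : (if degIn n (G.map Fin.valEmbedding) W i = 1 then W.erase i else W) = W := by
          split_ifs with h
          · exact Finset.erase_eq_of_notMem fun hi => hdel ⟨hi, h⟩
          · rfl
        rw [hsame] at k4
        refine ⟨W, hW, k1, k4, k3.imp_left fun k3 => ⟨k3.1, fun i' hi' hm => ?_⟩⟩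
        rcases Nat.lt_succ_iff_lt_or_eq.1 hi' with hi' | rfl
        · exact k3.2 i' hi' hm
        · exact fun h => hdel ⟨hm, h⟩
    · rintro s₂ - - ⟨W, hW, k1, k2, k3⟩
      refine ⟨W, hW, k1, k2, k3.imp_left fun k3 i hi => k3.2 i ?_ hi⟩
      simpa using hW hi

end

end RAM

/-! ### Growing a spanning tree -/

namespace RAM

/-- Array `k` holds the indicator function of `S`. -/
def Marks (n k : ℕ) (S : Finset ℕ) (s : State) : Prop :=
  ∀ v < n, s.arr (k, v) = if v ∈ S then 1 else 0

/-- Register `3` and arrays `4`, `5` hold an order of `S` along a tree. -/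
def HasTree (H : SimpleGraph ℕ) (S : Finset ℕ) (s : State) : Prop :=
  IsTreeOrder H S (s.reg 3) (fun t => s.arr (4, t)) fun v => s.arr (5, v)

section

variable {n N : ℕ} {H : SimpleGraph ℕ} {s s' : State} {S W : Finset ℕ}

theorem Marks.sameOff {R K : List ℕ} {k : ℕ} (h : Marks n k S s) (hs : SameOff R K s s')
    (hK : k ∉ K := by decide) : Marks n k S s' :=
  fun v hv => (hs.arr k hK v).trans (h v hv)

theorem Marks.insert {k i : ℕ} (h : Marks n k S s) : Marks n k (insert i S) (s.setArr k i 1) := by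
  intro v hv
  by_cases hvi : v = i
  · simp [hvi]
  · simpa [hvi] using h v hv

theorem HasTree.sameOff {R K : List ℕ} (h : HasTree H S s) (hs : SameOff R K s s')
    (hR : 3 ∉ R := by decide) (hK : 4 ∉ K ∧ 5 ∉ K := by decide) : HasTree H S s' := by
  have h4 := hs.arr 4 hK.1
  have h5 := hs.arr 5 hK.2
  simpa only [HasTree, h4, h5, hs.reg 3 hR] using h

theorem HasTree.card_eq (h : HasTree H S s) : S.card = s.reg 3 := IsTreeOrder.card_eq h

variable [DecidableRel H.Adj]

/-- Find a vertex that is not dead. -/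
def findRoot : Prog := forLoop 20 0 (.instr (.load 10 2 20) ⨟ .ite 10 skip (.instr (.op .add 11 20 9)))

theorem wp_findRoot (hs : Bounded N s) (hN : n * n + n + 4 ≤ N) (hc : Ctx n H s)
    (hd : MarksDead n W s) (hW : W ⊆ Finset.range n) (hne : W.Nonempty) :
    WP N findRoot s fun s' => s'.reg 11 ∈ W := by
  have hloop := WP.forLoop (r := 20) (M := n)
    (body := .instr (.load 10 2 20) ⨟ .ite 10 skip (.instr (.op .add 11 20 9)))
    (I := fun i s' => (∃ v < i, v ∈ W) → s'.reg 11 ∈ W) hs hc.reg0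
    (by omega) hc.reg1 (by decide) (fun _ _ _ _ h => by simpa using h) (by simp) ?_
  · obtain ⟨v, hv⟩ := hne
    exact hloop.mono fun s' _ _ h => h ⟨v, by simpa using hW hv, hv⟩
  · intro i s₁ hi hs₁ hsame h20 hI
    have hc₁ := hc.sameOff hsame
    have hd₁ := hd.sameOff hsame
    refine WP.seq' (WP.load hs₁ (v := if i ∈ W then 0 else 1) (by rw [h20]; exact hd₁ i hi)
      fun hs₂ => ?_)
    refine WP.ite hs₂ (fun h => wp_skip hs₂ ?_) fun h => WP.add hs₂ (v := i)
      (by simp [h20, hc₁.reg9]) (lt_four_pow_of_le (by omega)) fun _ => ?_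
    · have hiW : i ∉ W := by simpa using h
      rintro ⟨v, hv, hvW⟩
      rcases Nat.lt_succ_iff_lt_or_eq.1 hv with hv | rfl
      · simpa using hI ⟨v, hv, hvW⟩
      · exact absurd hvW hiW
    · have hiW : i ∈ W := by simpa using h
      exact fun _ => by simpa using hiW

/-- Start a tree with a single vertex. -/
def initTree : Prog :=
  findRoot ⨟ .instr (.store 4 9 11) ⨟ .instr (.store 5 11 11) ⨟ .instr (.store 3 11 1) ⨟
    .instr (.const 3 1)

theorem wp_initTree (hs : Bounded N s) (hN : n * n + n + 4 ≤ N) (hc : Ctx n H s)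
    (hd : MarksDead n W s) (hW : W ⊆ Finset.range n) (hne : W.Nonempty)
    (h3 : ∀ v, s.arr (3, v) = 0) :
    WP N initTree s fun s' => ∃ r ∈ W, Marks n 3 {r} s' ∧ HasTree H {r} s' := by
  refine WP.seq (wp_findRoot hs hN hc hd hW hne) fun s₁ hs₁ hsame hr => ?_
  have hc₁ : Ctx n H s₁ := hc.sameOff hsame
  have h3₁ : ∀ v, s₁.arr (3, v) = 0 := fun v => (hsame.arr 3 (by decide) v).trans (h3 v)
  have hrn : s₁.reg 11 < n := by simpa using hW hr
  set r := s₁.reg 11 with hr'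
  refine WP.seq' (WP.store hs₁ (i := 0) (v := r) hc₁.reg9 hr'.symm (by omega) fun hs₂ => ?_)
  refine WP.seq' (WP.store hs₂ (i := r) (v := r) hr'.symm hr'.symm (by omega) fun hs₃ => ?_)
  refine WP.seq' (WP.store hs₃ (i := r) (v := 1) hr'.symm hc₁.reg1 (by omega) fun hs₄ => ?_)
  refine WP.const hs₄ (by decide) (lt_four_pow_of_le (by omega)) fun _ => ⟨r, hr, ?_, ?_⟩
  · intro v hv
    by_cases hvr : v = r <;> simp [hvr, h3₁]
  · simp only [HasTree, State.setReg_reg, if_true]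
    refine IsTreeOrder.singleton (r := r) ?_ ?_ <;> simp

/-- Append the second end of the pair in register `22` to the tree if this pair is an edge that
leaves the tree. -/
def growStep : Prog :=
  .instr (.load 10 0 22) ⨟ .instr (.op .div 11 22 0) ⨟ .instr (.op .mod 12 22 0) ⨟
  .instr (.load 13 3 11) ⨟ .instr (.op .mul 10 10 13) ⨟
  .instr (.load 13 2 12) ⨟ .instr (.op .sub 10 10 13) ⨟
  .instr (.load 13 3 12) ⨟ .instr (.op .sub 10 10 13) ⨟
  .ite 10 (.instr (.store 3 12 1) ⨟ .instr (.store 5 12 11) ⨟ .instr (.store 4 3 12) ⨟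
    .instr (.op .add 3 3 1)) skip

theorem div_mod_lt {e : ℕ} (he : e < n * n) : e / n < n ∧ e % n < n :=
  ⟨Nat.div_lt_of_lt_mul he, Nat.mod_lt _ (Nat.pos_of_ne_zero fun h => by simp [h] at he)⟩

theorem wp_growStep (hs : Bounded N s) (hN : n * n + n + 4 ≤ N) (hc : Ctx n H s)
    (hd : MarksDead n W s) (hW : W ⊆ Finset.range n) (hSW : S ⊆ W) (hm : Marks n 3 S s)
    (ht : HasTree H S s) {e : ℕ} (he : e < n * n) (h22 : s.reg 22 = e) :
    WP N growStep s fun s' => ∃ S',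
      S' = (if H.Adj (e / n) (e % n) ∧ e / n ∈ S ∧ e % n ∈ W ∧ e % n ∉ S then insert (e % n) S
        else S) ∧ Marks n 3 S' s' ∧ HasTree H S' s' := by
  obtain ⟨hi, hj⟩ := div_mod_lt he
  set i := e / n
  set j := e % n
  refine WP.seq' (WP.load hs (v := if H.Adj i j then 1 else 0) (by rw [h22]; exact hc.adj e he)
    fun hs₁ => ?_)
  refine WP.seq' (WP.div hs₁ (v := i) (by simp [h22, hc.reg0, i]) fun hs₂ => ?_)
  refine WP.seq' (WP.mod hs₂ (v := j) (by simp [h22, hc.reg0, j]) fun hs₃ => ?_)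
  refine WP.seq' (WP.load hs₃ (v := if i ∈ S then 1 else 0) (by simpa using hm i hi)
    fun hs₄ => ?_)
  refine WP.seq' (WP.mul hs₄ (v := if H.Adj i j ∧ i ∈ S then 1 else 0) ?_ ?_ fun hs₅ => ?_)
  · by_cases h1 : H.Adj i j <;> by_cases h2 : i ∈ S <;> simp [h1, h2]
  · exact lt_four_pow_of_le (by split_ifs <;> omega)
  refine WP.seq' (WP.load hs₅ (v := if j ∈ W then 0 else 1) (by simpa using hd j hj)
    fun hs₆ => ?_)
  refine WP.seq' (WP.sub hs₆ (v := if H.Adj i j ∧ i ∈ S ∧ j ∈ W then 1 else 0) ?_ fun hs₇ => ?_)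
  · by_cases h1 : H.Adj i j <;> by_cases h2 : i ∈ S <;> by_cases h3 : j ∈ W <;> simp [h1, h2, h3]
  refine WP.seq' (WP.load hs₇ (v := if j ∈ S then 1 else 0) (by simpa using hm j hj)
    fun hs₈ => ?_)
  refine WP.seq' (WP.sub hs₈ (v := if H.Adj i j ∧ i ∈ S ∧ j ∈ W ∧ j ∉ S then 1 else 0) ?_
    fun hs₉ => ?_)
  · by_cases h1 : H.Adj i j <;> by_cases h2 : i ∈ S <;> by_cases h3 : j ∈ W <;>
      by_cases h4 : j ∈ S <;> simp [h1, h2, h3, h4]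
  set s₉ := State.setReg _ 10 (if H.Adj i j ∧ i ∈ S ∧ j ∈ W ∧ j ∉ S then 1 else 0)
  have hR : ∀ r, r ≠ 10 → r ≠ 11 → r ≠ 12 → r ≠ 13 → s₉.reg r = s.reg r := fun r h1 h2 h3 h4 => by
    simp [s₉, h1, h2, h3, h4]
  have e11 : s₉.reg 11 = i := by simp [s₉]
  have e12 : s₉.reg 12 = j := by simp [s₉]
  have e1 : s₉.reg 1 = 1 := by rw [hR 1 (by decide) (by decide) (by decide) (by decide), hc.reg1]
  have e3 : s₉.reg 3 = s.reg 3 := hR 3 (by decide) (by decide) (by decide) (by decide)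
  have hA : s₉.arr = s.arr := rfl
  have hm₉ : Marks n 3 S s₉ := hm
  have ht₉ : HasTree H S s₉ := by
    unfold HasTree
    rw [e3]
    exact ht
  refine WP.ite hs₉ (fun h => ?_) fun h => wp_skip hs₉ ?_
  · have hcond : H.Adj i j ∧ i ∈ S ∧ j ∈ W ∧ j ∉ S := by
      by_contra hcon
      exact h (by simp [s₉, hcon])
    have hlt : s.reg 3 < n := by
      have h1 : (insert j S).card ≤ n := by
        refine (Finset.card_le_card (?_ : _ ⊆ Finset.range n)).trans_eq (Finset.card_range n)
        exact Finset.insert_subset (by simpa using hj) (hSW.trans hW)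
      rw [Finset.card_insert_of_notMem hcond.2.2.2, ht.card_eq] at h1
      omega
    clear_value s₉
    refine WP.seq' (WP.store hs₉ e12 e1 (by omega) fun hs₁₀ => ?_)
    refine WP.seq' (WP.store hs₁₀ e12 e11 (by omega) fun hs₁₁ => ?_)
    refine WP.seq' (WP.store hs₁₁ e3 e12 (by omega) fun hs₁₂ => ?_)
    refine WP.add hs₁₂ (v := s.reg 3 + 1) (by simp [e3, e1]) (lt_four_pow_of_le (by omega))
      fun _ => ⟨_, (if_pos hcond).symm, ?_, ?_⟩
    · intro v hv
      simpa using (hm₉.insert (i := j)) v hv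
    · have := IsTreeOrder.insert (i := i) (j := j) ht₉ hcond.2.1 hcond.2.2.2 hcond.1
        (ord' := fun t => if t = s.reg 3 then j else s₉.arr (4, t))
        (par' := fun v => if v = j then i else s₉.arr (5, v))
        (fun t ht => by simp; omega) (by simp [e3])
        (fun v hv => by simp [hv]) (by simp)
      simpa [HasTree, e3] using this
  · have hcond : ¬ (H.Adj i j ∧ i ∈ S ∧ j ∈ W ∧ j ∉ S) := fun hcon => by simp [s₉, hcon] at h
    clear_value s₉
    refine ⟨_, (if_neg hcond).symm, fun v hv => hm₉ v hv, ?_⟩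
    simpa [HasTree] using ht₉

/-- Find a spanning tree of the vertices that are not dead. -/
def growTree : Prog := initTree ⨟ forLoop 20 0 (forLoop 22 2 growStep)

/-- A sweep over all pairs enlarges the tree unless it already spans `W`. It starts with one vertex,
so `n` sweeps suffice. -/
theorem wp_growTree (hs : Bounded N s) (hN : n * n + n + 4 ≤ N) (hc : Ctx n H s)
    (hd : MarksDead n W s) (hW : W ⊆ Finset.range n) (hne : W.Nonempty)
    (hcut : IsCutConnected H (W : Set ℕ)) (h3 : ∀ v, s.arr (3, v) = 0) :
    WP N growTree s (HasTree H W) := by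
  refine WP.seq (wp_initTree hs hN hc hd hW hne h3) fun s₁ hs₁ hsame ⟨r, hr, hmr, htr⟩ => ?_
  have hc₁ : Ctx n H s₁ := hc.sameOff hsame
  have hd₁ : MarksDead n W s₁ := hd.sameOff hsame
  have hWn : W.card ≤ n := by simpa using Finset.card_le_card hW
  refine (WP.forLoop (r := 20) (M := n) (body := forLoop 22 2 growStep)
    (I := fun t s' => ∃ S ⊆ W, Marks n 3 S s' ∧ HasTree H S s' ∧ (S = W ∨ t + 1 ≤ S.card))
    hs₁ hc₁.reg0 (by omega) hc₁.reg1 (by decide) ?_ ?_ ?_).mono ?_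
  · rintro i s' u v ⟨S, h1, h2, h3, h4⟩
    exact ⟨S, h1, h2, by simpa [HasTree] using h3, h4⟩
  · exact ⟨{r}, by simpa using hr, hmr, htr, by simp⟩
  · rintro t s₂ ht hs₂ hsame₂ - ⟨S₀, hS₀, k1, k2, k3⟩
    have hc₂ := hc₁.sameOff hsame₂
    have hd₂ := hd₁.sameOff hsame₂
    have hS₀ne : S₀.Nonempty := by
      rcases k3 with rfl | k3
      · exact hne
      · exact Finset.card_pos.1 (by omega)
    refine (WP.forLoop (r := 22) (M := n * n) (body := growStep)
      (I := fun e s' => ∃ S ⊆ W, Marks n 3 S s' ∧ HasTree H S s' ∧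
        ((S = S₀ ∧ ∀ e' < e, ¬ (H.Adj (e' / n) (e' % n) ∧ e' / n ∈ S ∧ e' % n ∈ W ∧ e' % n ∉ S)) ∨
          t + 2 ≤ S.card))
      hs₂ hc₂.reg2 (by omega) hc₂.reg1 (by decide) ?_ ?_ ?_).mono ?_
    · rintro i s' u v ⟨S, h1, h2, h3, h4⟩
      exact ⟨S, h1, h2, by simpa [HasTree] using h3, h4⟩
    · exact ⟨S₀, hS₀, k1, k2, .inl ⟨rfl, by omega⟩⟩
    · rintro e s₃ he hs₃ hsame₃ h22 ⟨S, hS, l1, l2, l3⟩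
      refine (wp_growStep hs₃ hN (hc₂.sameOff hsame₃) (hd₂.sameOff hsame₃) hW hS l1 l2 he
        h22).mono fun s₄ _ _ ⟨S', hS', m1, m2⟩ => ?_
      split_ifs at hS' with hcond
      · refine ⟨S', hS' ▸ Finset.insert_subset hcond.2.2.1 hS, m1, m2, .inr ?_⟩
        rw [hS', Finset.card_insert_of_notMem hcond.2.2.2]
        rcases l3 with ⟨rfl, -⟩ | l3
        · rcases k3 with rfl | k3
          · exact absurd hcond.2.2.1 hcond.2.2.2
          · omega
        · omega
      · subst hS'
        refine ⟨S', hS, m1, m2, l3.imp_left fun l3 => ⟨l3.1, fun e' he' => ?_⟩⟩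
        rcases Nat.lt_succ_iff_lt_or_eq.1 he' with he' | rfl
        · exact l3.2 e' he'
        · exact hcond
    · rintro s₃ - - ⟨S, hS, l1, l2, l3⟩
      refine ⟨S, hS, l1, l2, l3.imp (fun l4 => ?_) id⟩
      obtain ⟨rfl, l4⟩ := l4
      by_contra hSW
      -- The sweep added nothing although it met every pair, whereas a proper part of `W` would have
      -- an outgoing edge.
      obtain ⟨i, hi, j, ⟨hj, hj'⟩, ha⟩ := hcut S (by exact_mod_cast hS) (by exact_mod_cast hS₀ne)
        (by exact_mod_cast hSW)
      have hin : i < n := by simpa using hW (hS hi)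
      have hjn : j < n := by simpa using hW hj
      obtain ⟨h1, h2⟩ := mul_add_div_mod i hjn
      exact l4 _ (mul_add_lt_sq hin hjn) (by rw [h1, h2]; exact ⟨ha, hi, hj, hj'⟩)
  · rintro s₂ - - ⟨S, hS, k1, k2, k3⟩
    rcases k3 with rfl | k3
    · exact k2
    · have := Finset.card_le_card hS
      omega

end

end RAM

/-! ### Non-tree edges and the choice between the two systems of guesses -/

namespace RAM

/-- Register `4` and arrays `6`, `7` list the edges outside the tree among the first `e` pairs. -/
structure ListsEdges (H : SimpleGraph ℕ) (S : Finset ℕ) (par : ℕ → ℕ) (n e : ℕ) (s : State) :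
    Prop where
  le : s.reg 4 ≤ e
  mem : ∀ t < s.reg 4, IsNonTreeEdge H S par (s.arr (6, t)) (s.arr (7, t)) ∧
    ∃ e' < e, s.arr (6, t) = e' / n ∧ s.arr (7, t) = e' % n
  all : ∀ e' < e, IsNonTreeEdge H S par (e' / n) (e' % n) →
    ∃ t < s.reg 4, s.arr (6, t) = e' / n ∧ s.arr (7, t) = e' % n
  inj : ∀ t < s.reg 4, ∀ t' < s.reg 4, s.arr (6, t) = s.arr (6, t') →
    s.arr (7, t) = s.arr (7, t') → t = t'

section

variable {n N : ℕ} {H : SimpleGraph ℕ} {s s' : State} {S W : Finset ℕ} {par : ℕ → ℕ} {e : ℕ}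

theorem ListsEdges.congr (h : ListsEdges H S par n e s) (h4 : s'.reg 4 = s.reg 4)
    (h6 : ∀ t, s'.arr (6, t) = s.arr (6, t)) (h7 : ∀ t, s'.arr (7, t) = s.arr (7, t)) :
    ListsEdges H S par n e s' := by
  obtain ⟨k1, k2, k3, k4⟩ := h
  exact ⟨by rwa [h4], by simpa only [h4, h6, h7] using k2, by simpa only [h4, h6, h7] using k3,
    by simpa only [h4, h6, h7] using k4⟩

theorem ListsEdges.succ_of_not (h : ListsEdges H S par n e s)
    (he : ¬ IsNonTreeEdge H S par (e / n) (e % n)) : ListsEdges H S par n (e + 1) s := by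
  obtain ⟨k1, k2, k3, k4⟩ := h
  refine ⟨by omega, fun t ht => ?_, fun e' he' hn => ?_, k4⟩
  · obtain ⟨l1, e', l2, l3⟩ := k2 t ht
    exact ⟨l1, e', by omega, l3⟩
  · rcases Nat.lt_succ_iff_lt_or_eq.1 he' with he' | rfl
    · exact k3 e' he' hn
    · exact absurd hn he

theorem ListsEdges.succ_of (h : ListsEdges H S par n e s)
    (he : IsNonTreeEdge H S par (e / n) (e % n)) (h4 : s'.reg 4 = s.reg 4 + 1)
    (h6 : ∀ t, s'.arr (6, t) = if t = s.reg 4 then e / n else s.arr (6, t))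
    (h7 : ∀ t, s'.arr (7, t) = if t = s.reg 4 then e % n else s.arr (7, t)) :
    ListsEdges H S par n (e + 1) s' := by
  obtain ⟨k1, k2, k3, k4⟩ := h
  have hold : ∀ t < s.reg 4, s'.arr (6, t) = s.arr (6, t) ∧ s'.arr (7, t) = s.arr (7, t) :=
    fun t ht => by rw [h6, h7, if_neg (by omega), if_neg (by omega)]; exact ⟨rfl, rfl⟩
  have hnew : s'.arr (6, s.reg 4) = e / n ∧ s'.arr (7, s.reg 4) = e % n := by simp [h6, h7]
  have hne : ∀ t < s.reg 4, s.arr (6, t) = e / n → s.arr (7, t) = e % n → False := by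
    intro t ht e1 e2
    obtain ⟨-, e', l1, l2, l3⟩ := k2 t ht
    have : e' = e := by
      rw [← Nat.div_add_mod e' n, ← Nat.div_add_mod e n, ← l2, ← l3, e1, e2]
    omega
  refine ⟨by omega, fun t ht => ?_, fun e' he' hn => ?_, fun t ht t' ht' e1 e2 => ?_⟩
  · rcases Nat.lt_succ_iff_lt_or_eq.1 (h4 ▸ ht) with ht | rfl
    · obtain ⟨l1, e', l2, l3⟩ := k2 t ht
      rw [(hold t ht).1, (hold t ht).2]
      exact ⟨l1, e', by omega, l3⟩
    · rw [hnew.1, hnew.2]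
      exact ⟨he, e, by omega, rfl, rfl⟩
  · rcases Nat.lt_succ_iff_lt_or_eq.1 he' with he' | rfl
    · obtain ⟨t, ht, l⟩ := k3 e' he' hn
      exact ⟨t, by omega, by rwa [(hold t ht).1, (hold t ht).2]⟩
    · exact ⟨_, by omega, hnew⟩
  · rcases Nat.lt_succ_iff_lt_or_eq.1 (h4 ▸ ht) with ht | rfl <;>
      rcases Nat.lt_succ_iff_lt_or_eq.1 (h4 ▸ ht') with ht' | rfl
    · rw [(hold t ht).1, (hold t' ht').1] at e1
      rw [(hold t ht).2, (hold t' ht').2] at e2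
      exact k4 t ht t' ht' e1 e2
    · rw [(hold t ht).1, hnew.1] at e1
      rw [(hold t ht).2, hnew.2] at e2
      exact (hne t ht e1 e2).elim
    · rw [(hold t' ht').1, hnew.1] at e1
      rw [(hold t' ht').2, hnew.2] at e2
      exact (hne t' ht' e1.symm e2.symm).elim
    · rfl

variable [DecidableRel H.Adj]

/-- List the pair in register `22` if it is an edge outside the tree. -/
def listStep : Prog :=
  .instr (.load 10 0 22) ⨟ .instr (.op .div 11 22 0) ⨟ .instr (.op .mod 12 22 0) ⨟
  .instr (.load 13 2 11) ⨟ .instr (.op .sub 10 10 13) ⨟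
  .instr (.load 13 2 12) ⨟ .instr (.op .sub 10 10 13) ⨟
  .ite 10
    (.instr (.op .sub 14 11 12) ⨟ .instr (.load 13 5 11) ⨟ .instr (.op .sub 15 13 12) ⨟
      .instr (.op .sub 13 12 13) ⨟ .instr (.op .add 15 15 13) ⨟
      .instr (.load 13 5 12) ⨟ .instr (.op .sub 16 13 11) ⨟
      .instr (.op .sub 13 11 13) ⨟ .instr (.op .add 16 16 13) ⨟
      .ite 14 (.ite 15 (.ite 16 (.instr (.store 6 4 11) ⨟ .instr (.store 7 4 12) ⨟
        .instr (.op .add 4 4 1)) skip) skip) skip) skip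

theorem wp_listStep (hs : Bounded N s) (hN : n * n + n + 4 ≤ N) (hc : Ctx n H s)
    (hd : MarksDead n W s) (hW : W ⊆ Finset.range n) (hpar : ∀ v, s.arr (5, v) = par v)
    (hpW : ∀ v ∈ W, par v ∈ W) (he : e < n * n) (h22 : s.reg 22 = e)
    (hl : ListsEdges H W par n e s) :
    WP N listStep s (ListsEdges H W par n (e + 1)) := by
  obtain ⟨hi, hj⟩ := div_mod_lt he
  have hadj := hc.adj e he
  obtain ⟨i, hi'⟩ : ∃ i, i = e / n := ⟨_, rfl⟩
  obtain ⟨j, hj'⟩ : ∃ j, j = e % n := ⟨_, rfl⟩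
  rw [← hi'] at hi hadj
  rw [← hj'] at hj hadj
  refine WP.seq' (WP.load hs (v := if H.Adj i j then 1 else 0) (by rw [h22]; exact hadj)
    fun hs₁ => ?_)
  refine WP.seq' (WP.div hs₁ (v := i) (by simp [h22, hc.reg0, hi']) fun hs₂ => ?_)
  refine WP.seq' (WP.mod hs₂ (v := j) (by simp [h22, hc.reg0, hj']) fun hs₃ => ?_)
  refine WP.seq' (WP.load hs₃ (v := if i ∈ W then 0 else 1) (by simpa using hd i hi)
    fun hs₄ => ?_)
  refine WP.seq' (WP.sub hs₄ (v := if H.Adj i j ∧ i ∈ W then 1 else 0) ?_ fun hs₅ => ?_)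
  · by_cases h1 : H.Adj i j <;> by_cases h2 : i ∈ W <;> simp [h1, h2]
  refine WP.seq' (WP.load hs₅ (v := if j ∈ W then 0 else 1) (by simpa using hd j hj)
    fun hs₆ => ?_)
  refine WP.seq' (WP.sub hs₆ (v := if H.Adj i j ∧ i ∈ W ∧ j ∈ W then 1 else 0) ?_ fun hs₇ => ?_)
  · by_cases h1 : H.Adj i j <;> by_cases h2 : i ∈ W <;> by_cases h3 : j ∈ W <;> simp [h1, h2, h3]
  have hno : ∀ s' : State, s'.reg 4 = s.reg 4 → s'.arr = s.arr → ¬ IsNonTreeEdge H W par i j →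
      ListsEdges H W par n (e + 1) s' := fun s' h4 harr hne =>
    (hl.succ_of_not (by rwa [← hi', ← hj'])).congr h4 (fun t => by rw [harr]) fun t => by rw [harr]
  refine WP.ite hs₇ (fun h => ?_) fun h => wp_skip hs₇ (hno _ (by simp) (by simp) fun hne => ?_)
  swap
  · simp [hne.1, hne.2.1, hne.2.2.1] at h
  have hcond : H.Adj i j ∧ i ∈ W ∧ j ∈ W := by
    by_contra hcon
    exact h (by simp [hcon])
  have hpi : par i < n := by simpa using hW (hpW i hcond.2.1)
  have hpj : par j < n := by simpa using hW (hpW j hcond.2.2)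
  clear h
  refine WP.seq' (WP.sub hs₇ (v := i - j) (by simp) fun hs₈ => ?_)
  refine WP.seq' (WP.load hs₈ (v := par i) (by simp [hpar]) fun hs₉ => ?_)
  refine WP.seq' (WP.sub hs₉ (v := par i - j) (by simp) fun hs₁₀ => ?_)
  refine WP.seq' (WP.sub hs₁₀ (v := j - par i) (by simp) fun hs₁₁ => ?_)
  -- The sum of the two truncated differences is the distance, which is nonzero exactly if the
  -- numbers differ.
  refine WP.seq' (WP.add hs₁₁ (v := par i - j + (j - par i)) (by simp)
    (lt_four_pow_of_le (by omega)) fun hs₁₂ => ?_)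
  refine WP.seq' (WP.load hs₁₂ (v := par j) (by simp [hpar]) fun hs₁₃ => ?_)
  refine WP.seq' (WP.sub hs₁₃ (v := par j - i) (by simp) fun hs₁₄ => ?_)
  refine WP.seq' (WP.sub hs₁₄ (v := i - par j) (by simp) fun hs₁₅ => ?_)
  refine WP.seq' (WP.add hs₁₅ (v := par j - i + (i - par j)) (by simp)
    (lt_four_pow_of_le (by omega)) fun hs₁₆ => ?_)
  set s₁ := State.setReg _ 16 (par j - i + (i - par j))
  have e4 : s₁.reg 4 = s.reg 4 := by simp [s₁]
  have e1 : s₁.reg 1 = 1 := by simp [s₁, hc.reg1]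
  have e11 : s₁.reg 11 = i := by simp [s₁]
  have e12 : s₁.reg 12 = j := by simp [s₁]
  have e14 : s₁.reg 14 = i - j := by simp [s₁]
  have e15 : s₁.reg 15 = par i - j + (j - par i) := by simp [s₁]
  have e16 : s₁.reg 16 = par j - i + (i - par j) := by simp [s₁]
  have hA : s₁.arr = s.arr := rfl
  clear_value s₁
  have hle := hl.le
  refine WP.ite hs₁₆ (fun h14 => ?_) fun h14 => wp_skip hs₁₆ (hno _ (by simp [e4]) hA fun hne => ?_)
  swap
  · have := hne.2.2.2.1
    omega
  refine WP.ite hs₁₆ (fun h15 => ?_) fun h15 => wp_skip hs₁₆ (hno _ (by simp [e4]) hA fun hne => ?_)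
  swap
  · have := hne.2.2.2.2.1
    omega
  refine WP.ite hs₁₆ (fun h16 => ?_) fun h16 => wp_skip hs₁₆ (hno _ (by simp [e4]) hA fun hne => ?_)
  swap
  · have := hne.2.2.2.2.2
    omega
  refine WP.seq' (WP.store hs₁₆ e4 e11 (by omega) fun hs₁₇ => ?_)
  refine WP.seq' (WP.store hs₁₇ e4 e12 (by omega) fun hs₁₈ => ?_)
  refine WP.add hs₁₈ (v := s.reg 4 + 1) (by simp [e4, e1]) (lt_four_pow_of_le (by omega)) fun _ => ?_
  refine hl.succ_of (by rw [← hi', ← hj']; exact ⟨hcond.1, hcond.2.1, hcond.2.2, by omega, by omega, by omega⟩) (by simp)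
    (fun t => ?_) fun t => ?_
  · simp [hA, hi']
  · simp [hA, hj']

/-- List the edges outside the tree. -/
def listEdges : Prog := .instr (.const 4 0) ⨟ forLoop 22 2 listStep

theorem wp_listEdges (hs : Bounded N s) (hN : n * n + n + 4 ≤ N) (hc : Ctx n H s)
    (hd : MarksDead n W s) (hW : W ⊆ Finset.range n) (ht : HasTree H W s) :
    WP N listEdges s (ListsEdges H W (fun v => s.arr (5, v)) n (n * n)) := by
  refine WP.seq' (WP.const hs (by decide) (by positivity) fun hs₁ => ?_)
  refine WP.forLoop (r := 22) (M := n * n) (body := listStep)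
    (I := ListsEdges H W (fun v => s.arr (5, v)) n) hs₁ hc.setReg.reg2 (by omega) hc.setReg.reg1
    (by decide) (fun i s' u v h => h.congr (by simp) (by simp) (by simp)) ?_ ?_
  · exact ⟨by simp, by simp, by omega, by simp⟩
  · intro e s₂ he hs₂ hsame h22 hl
    exact wp_listStep hs₂ hN (hc.setReg.sameOff hsame)
      (fun v hv => (hsame.arr 2 (by decide) v).trans (hd v hv)) hW
      (fun v => hsame.arr 5 (by decide) v) (fun v hv => IsTreeOrder.par_mem ht hv) he h22 hl

/-- Multiply register `a` repeatedly by register `b`, register `m` times. -/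
def powLoop (a b m : ℕ) : Prog := forLoop 20 m (.instr (.op .mul a a b))

-- The bases `2` and `3` are at most `4` and the exponents stay below `N`, so the powers remain
-- below `4 ^ N`; this is the reason for that bound on values.
omit [DecidableRel H.Adj] in
theorem wp_powLoop {a b m x k : ℕ} (hs : Bounded N s) (h1 : s.reg 1 = 1) (ha : s.reg a = 1)
    (hb : s.reg b = x) (hm : s.reg m = k) (hk : k < N) (hx : x ≤ 4)
    (hside : a < 20 ∧ b < 20 ∧ m < 20 ∧ a ≠ 1 ∧ a ≠ b ∧ a ≠ m) :
    WP N (powLoop a b m) s fun s' => s'.reg a = x ^ k := by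
  obtain ⟨ha20, hb20, hm20, ha1, hab, ham⟩ := hside
  refine WP.forLoop (r := 20) (M := k) (I := fun i s' => s'.reg a = x ^ i) hs hm hk.le h1 ?_ ?_
    (by simpa using ha) ?_
  · simp only [Prog.wr, List.mem_singleton]
    omega
  · intro i s' u v h
    rw [State.setReg_reg, if_neg (by omega), State.setReg_reg, if_neg (by omega), h]
  · intro i s' hi hs' hsame h20 h
    have hb' : s'.reg b = x := by
      rw [hsame.reg b (by simp [Prog.wr]; omega), hb]
    refine WP.mul hs' (v := x ^ (i + 1)) (by rw [h, hb', pow_succ]) ?_ (fun _ => by simp) (by omega)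
    exact (Nat.pow_le_pow_left hx _).trans_lt (Nat.pow_lt_pow_right (by norm_num) (by omega))

/-- Registers `5`, `6`, `7` and arrays `6`, `7` hold a system of guesses: the base, the number of
items, the number of guesses, and the items. -/
structure HasGuesses (N : ℕ) (H : SimpleGraph ℕ) (W : Finset ℕ) (s : State) : Prop where
  pow : s.reg 7 = s.reg 5 ^ s.reg 6
  lt : s.reg 6 < N
  lt_pow : s.reg 7 < 4 ^ N
  sys : IsGuessSystem H W (s.reg 3) (fun t => s.arr (4, t)) (fun v => s.arr (5, v)) (s.reg 5)
    (s.reg 6) (fun t => s.arr (6, t)) fun t => s.arr (7, t)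

/-- Use the tree order itself as the list of items. -/
def useVertices : Prog :=
  .instr (.const 5 2) ⨟ .instr (.op .add 7 11 9) ⨟ .instr (.op .add 6 3 9) ⨟
    forLoop 20 3 (.instr (.load 10 4 20) ⨟ .instr (.store 6 20 10) ⨟ .instr (.store 7 20 10))

theorem wp_useVertices (hs : Bounded N s) (hN : n * n + n + 4 ≤ N) (hc : Ctx n H s)
    (ht : HasTree H W s) (hWn : W.card ≤ n) (h11 : s.reg 11 = 2 ^ s.reg 3) :
    WP N useVertices s fun s' => HasGuesses N H W s' ∧ s'.reg 7 = 2 ^ s.reg 3 := by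
  have h3 : s.reg 3 ≤ n := by rw [← ht.card_eq]; exact hWn
  have h11lt := hs.reg_lt 11
  refine WP.seq' (WP.const hs (by decide) (lt_four_pow_of_le (by omega)) fun hs₁ => ?_)
  refine WP.seq' (WP.add hs₁ (v := s.reg 11) (by simp [hc.reg9]) h11lt fun hs₂ => ?_)
  refine WP.seq' (WP.add hs₂ (v := s.reg 3) (by simp [hc.reg9])
    (lt_four_pow_of_le (by omega)) fun hs₃ => ?_)
  set s₁ := State.setReg _ 6 (s.reg 3)
  have e3 : s₁.reg 3 = s.reg 3 := by simp [s₁]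
  have e5 : s₁.reg 5 = 2 := by simp [s₁]
  have e6 : s₁.reg 6 = s.reg 3 := by simp [s₁]
  have e7 : s₁.reg 7 = s.reg 11 := by simp [s₁]
  have hc₁ : Ctx n H s₁ := hc.setReg.setReg.setReg
  have hA : s₁.arr = s.arr := rfl
  clear_value s₁
  refine (WP.forLoop (r := 20) (M := s.reg 3) (I := fun i s' => ∀ t < i,
    s'.arr (6, t) = s.arr (4, t) ∧ s'.arr (7, t) = s.arr (4, t)) hs₃ e3 (by omega) hc₁.reg1
    (by decide) (fun _ _ _ _ h => h) (by simp) ?_).mono fun s₂ hs₂ hsame h => ?_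
  · intro i s₂ hi hs₂ hsame h20 hI
    refine WP.seq' (WP.load hs₂ (v := s.arr (4, i)) (by rw [h20, hsame.arr 4 (by decide), hA])
      fun hs₃ => ?_)
    refine WP.seq' (WP.store hs₃ (i := i) (v := s.arr (4, i)) (by simpa) (by simp) (by omega)
      fun hs₄ => ?_)
    refine WP.store hs₄ (i := i) (v := s.arr (4, i)) (by simpa) (by simp) (by omega) fun _ => ?_
    intro t ht
    rcases Nat.lt_succ_iff_lt_or_eq.1 ht with ht | rfl
    · simp [ht.ne, hI t ht]
    · simp
  · have k3 : s₂.reg 3 = s.reg 3 := (hsame.reg 3 (by decide)).trans e3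
    have k5 : s₂.reg 5 = 2 := (hsame.reg 5 (by decide)).trans e5
    have k6 : s₂.reg 6 = s.reg 3 := (hsame.reg 6 (by decide)).trans e6
    have k7 : s₂.reg 7 = s.reg 11 := (hsame.reg 7 (by decide)).trans e7
    have a4 : ∀ t, s₂.arr (4, t) = s.arr (4, t) := fun t => by rw [hsame.arr 4 (by decide), hA]
    have a5 : ∀ t, s₂.arr (5, t) = s.arr (5, t) := fun t => by rw [hsame.arr 5 (by decide), hA]
    refine ⟨⟨by rw [k5, k6, k7, h11], by omega, hs₂.reg_lt 7, ?_⟩, by rw [k7, h11]⟩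
    simp only [a4, a5, k3, k5, k6]
    exact IsGuessSystem.of_vertices ht (fun t ht => (h t ht).1) fun t ht => (h t ht).2

/-- Choose the cheaper system of guesses. -/
def chooseGuesses : Prog :=
  .instr (.const 5 3) ⨟ .instr (.const 7 1) ⨟ .instr (.const 10 2) ⨟ .instr (.const 11 1) ⨟
  powLoop 7 5 4 ⨟ powLoop 11 10 3 ⨟ .instr (.op .add 6 4 9) ⨟ .instr (.op .sub 12 7 11) ⨟
  .ite 12 useVertices skip

theorem wp_chooseGuesses (hs : Bounded N s) (hN : n * n + n + 4 ≤ N) (hc : Ctx n H s)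
    (hW : W ⊆ Finset.range n) (ht : HasTree H W s)
    (hl : ListsEdges H W (fun v => s.arr (5, v)) n (n * n) s) :
    WP N chooseGuesses s fun s' => HasGuesses N H W s' ∧
      s'.reg 7 = min (3 ^ s.reg 4) (2 ^ s.reg 3) := by
  have hWn : W.card ≤ n := by simpa using Finset.card_le_card hW
  have h3 : s.reg 3 ≤ n := by rw [← ht.card_eq]; exact hWn
  have h4 := hl.le
  refine WP.seq' (WP.const hs (by decide) (lt_four_pow_of_le (by omega)) fun hs₁ => ?_)
  refine WP.seq' (WP.const hs₁ (by decide) (lt_four_pow_of_le (by omega)) fun hs₂ => ?_)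
  refine WP.seq' (WP.const hs₂ (by decide) (lt_four_pow_of_le (by omega)) fun hs₃ => ?_)
  refine WP.seq' (WP.const hs₃ (by decide) (lt_four_pow_of_le (by omega)) fun hs₄ => ?_)
  have hc₄ := (((hc.setReg (d := 5) (v := 3)).setReg (d := 7) (v := 1)).setReg
    (d := 10) (v := 2)).setReg (d := 11) (v := 1)
  refine WP.seq (wp_powLoop (x := 3) (k := s.reg 4) hs₄ hc₄.reg1 (by simp) (by simp) (by simp)
    (by omega) (by norm_num) (by decide)) fun s₅ hs₅ hsame₅ h7 => ?_
  have hc₅ := hc₄.sameOff hsame₅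
  have a3 : s₅.reg 3 = s.reg 3 := by rw [hsame₅.reg 3 (by decide)]; simp
  have a4 : s₅.reg 4 = s.reg 4 := by rw [hsame₅.reg 4 (by decide)]; simp
  have a5 : s₅.reg 5 = 3 := by rw [hsame₅.reg 5 (by decide)]; simp
  have a10 : s₅.reg 10 = 2 := by rw [hsame₅.reg 10 (by decide)]; simp
  have a11 : s₅.reg 11 = 1 := by rw [hsame₅.reg 11 (by decide)]; simp
  have aA : ∀ k i, s₅.arr (k, i) = s.arr (k, i) := fun k i => hsame₅.arr k (by simp [powLoop,
    RAM.forLoop, Prog.wa]) i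
  clear hsame₅
  refine WP.seq (wp_powLoop (x := 2) (k := s.reg 3) hs₅ hc₅.reg1 a11 a10 a3
    (by omega) (by norm_num) (by decide)) fun s₆ hs₆ hsame₆ h11 => ?_
  have hc₆ := hc₅.sameOff hsame₆
  have b3 : s₆.reg 3 = s.reg 3 := by rw [hsame₆.reg 3 (by decide), a3]
  have b4 : s₆.reg 4 = s.reg 4 := by rw [hsame₆.reg 4 (by decide), a4]
  have b5 : s₆.reg 5 = 3 := by rw [hsame₆.reg 5 (by decide), a5]
  have b7 : s₆.reg 7 = 3 ^ s.reg 4 := by rw [hsame₆.reg 7 (by decide), h7]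
  have bA : ∀ k i, s₆.arr (k, i) = s.arr (k, i) := fun k i => by
    rw [hsame₆.arr k (by simp [powLoop, RAM.forLoop, Prog.wa]), aA]
  clear hsame₆
  refine WP.seq' (WP.add hs₆ (v := s.reg 4) (by simp [b4, hc₆.reg9])
    (lt_four_pow_of_le (by omega)) fun hs₇ => ?_)
  -- A nonzero difference means that guessing vertices is strictly cheaper. Otherwise the listed
  -- edges already stand in the arrays of items.
  refine WP.seq' (WP.sub hs₇ (v := 3 ^ s.reg 4 - 2 ^ s.reg 3) (by simp [b7, h11])
    fun hs₈ => ?_)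
  refine WP.ite hs₈ (fun h => ?_) fun h => wp_skip hs₈ ?_
  · have hlt : 2 ^ s.reg 3 < 3 ^ s.reg 4 := by
      simp only [State.setReg_reg, if_true] at h
      omega
    refine (wp_useVertices hs₈ hN hc₆.setReg.setReg (W := W) (by simpa [HasTree, b3, bA] using ht)
      hWn (by simp [h11, b3])).mono fun s₉ _ _ k => ⟨k.1, ?_⟩
    rw [k.2, min_eq_right hlt.le]
    simp [b3]
  · have hle : 3 ^ s.reg 4 ≤ 2 ^ s.reg 3 := by
      simp only [State.setReg_reg, if_true] at h
      omega
    refine ⟨⟨by simp [b5, b7], by simp; omega, ?_, ?_⟩, by simp [b7, hle]⟩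
    · have := hs₆.reg_lt 7
      simpa using this
    · have := IsGuessSystem.of_edges (u := fun t => s.arr (6, t)) (v := fun t => s.arr (7, t)) ht
        (fun t ht => (hl.mem t ht).1) (fun i j hij => ?_)
      · simpa [b3, b5, bA] using this
      · have hi : i < n := by simpa using hW hij.2.1
        have hj : j < n := by simpa using hW hij.2.2.1
        obtain ⟨h1, h2⟩ := mul_add_div_mod i hj
        have := hl.all _ (mul_add_lt_sq hi hj) (by rwa [h1, h2])
        rwa [h1, h2] at this

end

end RAM

/-! ### Treating a single guess -/

namespace RAM

/-- The state that is common to all guesses: the tree and the system of guesses. -/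
structure GuessCtx (n : ℕ) (H : SimpleGraph ℕ) [DecidableRel H.Adj] (cnt : ℕ) (ord par : ℕ → ℕ)
    (b k : ℕ) (u v : ℕ → ℕ) (s : State) : Prop where
  ctx : Ctx n H s
  reg3 : s.reg 3 = cnt
  reg5 : s.reg 5 = b
  reg6 : s.reg 6 = k
  arr4 : ∀ t, s.arr (4, t) = ord t
  arr5 : ∀ t, s.arr (5, t) = par t
  arr6 : ∀ t, s.arr (6, t) = u t
  arr7 : ∀ t, s.arr (7, t) = v t

/-- The digits of `c` to the base `b`. -/
def digit (b c t : ℕ) : ℕ := c / b ^ t % b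

section

variable {n N : ℕ} {H : SimpleGraph ℕ} [DecidableRel H.Adj] {cnt : ℕ} {ord par : ℕ → ℕ}
  {b k : ℕ} {u v : ℕ → ℕ} {s s' : State} {S W X I M : Finset ℕ}

theorem GuessCtx.sameOff {R K : List ℕ} (h : GuessCtx n H cnt ord par b k u v s)
    (hs : SameOff R K s s')
    (hR : (0 ∉ R ∧ 1 ∉ R ∧ 2 ∉ R ∧ 9 ∉ R) ∧ 3 ∉ R ∧ 5 ∉ R ∧ 6 ∉ R := by decide)
    (hK : 0 ∉ K ∧ 4 ∉ K ∧ 5 ∉ K ∧ 6 ∉ K ∧ 7 ∉ K := by decide) :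
    GuessCtx n H cnt ord par b k u v s' := by
  obtain ⟨h0, h4, h5, h6, h7⟩ := hK
  exact ⟨h.ctx.sameOff hs hR.1 h0, (hs.reg 3 hR.2.1).trans h.reg3,
    (hs.reg 5 hR.2.2.1).trans h.reg5, (hs.reg 6 hR.2.2.2).trans h.reg6,
    fun t => (hs.arr 4 h4 t).trans (h.arr4 t), fun t => (hs.arr 5 h5 t).trans (h.arr5 t),
    fun t => (hs.arr 6 h6 t).trans (h.arr6 t), fun t => (hs.arr 7 h7 t).trans (h.arr7 t)⟩

theorem GuessCtx.setReg (h : GuessCtx n H cnt ord par b k u v s) {d x : ℕ}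
    (hd : (d ≠ 0 ∧ d ≠ 1 ∧ d ≠ 2 ∧ d ≠ 9) ∧ d ≠ 3 ∧ d ≠ 5 ∧ d ≠ 6 := by decide) :
    GuessCtx n H cnt ord par b k u v (s.setReg d x) :=
  ⟨h.ctx.setReg hd.1, by simp [hd.2.1.symm, h.reg3], by simp [hd.2.2.1.symm, h.reg5],
    by simp [hd.2.2.2.symm, h.reg6], h.arr4, h.arr5, h.arr6, h.arr7⟩

/-- Clear arrays `8` and `9`. -/
def clearMarks : Prog := forLoop 20 0 (.instr (.store 8 20 9) ⨟ .instr (.store 9 20 9))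

theorem wp_clearMarks (hs : Bounded N s) (hN : n * n + n + 4 ≤ N) (hc : Ctx n H s) :
    WP N clearMarks s fun s' => Marks n 8 ∅ s' ∧ Marks n 9 ∅ s' := by
  refine (WP.forLoop (r := 20) (M := n) (I := fun i s' => ∀ v < i,
    s'.arr (8, v) = 0 ∧ s'.arr (9, v) = 0) hs hc.reg0 (by omega) hc.reg1 (by decide)
    (fun _ _ _ _ h => h) (by simp) ?_).mono fun s₁ _ _ h =>
      ⟨fun v hv => by simpa using (h v hv).1, fun v hv => by simpa using (h v hv).2⟩
  intro i s₁ hi hs₁ hsame h20 hI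
  have hc₁ := hc.sameOff hsame
  refine WP.seq' (WP.store hs₁ h20 hc₁.reg9 (by omega) fun hs₂ => ?_)
  refine WP.store hs₂ (i := i) (v := 0) (by simpa) (by simpa using hc₁.reg9) (by omega) fun _ => ?_
  intro t ht
  rcases Nat.lt_succ_iff_lt_or_eq.1 ht with ht | rfl
  · simp [ht.ne, hI t ht]
  · simp

/-- Choose the vertices of the guess whose number is in register `30`. -/
def decodeGuess : Prog :=
  .instr (.op .add 10 30 9) ⨟ forLoop 20 6 (.instr (.op .mod 11 10 5) ⨟ .instr (.op .div 10 10 5) ⨟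
    .ite 11 (.instr (.op .sub 11 11 1) ⨟ .instr (.load 12 7 20) ⨟ .instr (.load 13 6 20) ⨟
      .ite 11 (.instr (.store 8 12 1)) (.instr (.store 8 13 1))) skip)

theorem wp_decodeGuess (hs : Bounded N s) (hN : n * n + n + 4 ≤ N)
    (hc : GuessCtx n H cnt ord par b k u v s) (hk : k < N) (hm : Marks n 8 ∅ s)
    (huv : ∀ t < k, u t < n ∧ v t < n) {c : ℕ} (h30 : s.reg 30 = c) :
    WP N decodeGuess s (Marks n 8 (guessSet u v (digit b c) k)) := by
  refine WP.seq' (WP.add hs (v := c) (by simp [h30, hc.ctx.reg9]) (h30 ▸ hs.reg_lt 30)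
    fun hs₁ => ?_)
  have hc₁ := hc.setReg (d := 10) (x := c)
  refine (WP.forLoop (r := 20) (M := k) (I := fun t s' => s'.reg 10 = c / b ^ t ∧
    Marks n 8 (guessSet u v (digit b c) t) s') hs₁ hc₁.reg6 hk.le hc₁.ctx.reg1 (by decide) ?_ ?_
    ?_).mono fun _ _ _ h => h.2
  · rintro i s' x y ⟨h1, h2⟩
    exact ⟨by simpa using h1, h2⟩
  · rw [guessSet_zero]
    exact ⟨by simp, hm⟩
  · rintro t s₂ ht hs₂ hsame h20 ⟨h10, hm₂⟩
    have hc₂ := hc₁.sameOff hsame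
    obtain ⟨hu, hv⟩ := huv t ht
    refine WP.seq' (WP.mod hs₂ (v := digit b c t) (by simp [h10, hc₂.reg5, digit]) fun hs₃ => ?_)
    refine WP.seq' (WP.div hs₃ (v := c / b ^ (t + 1))
      (by simp [h10, hc₂.reg5, Nat.div_div_eq_div_mul, pow_succ]) fun hs₄ => ?_)
    rw [guessSet_succ]
    refine WP.ite hs₄ (fun h => ?_) fun h => wp_skip hs₄ ?_
    · have h0 : digit b c t ≠ 0 := by simpa using h
      rw [if_neg h0]
      refine WP.seq' (WP.sub hs₄ (v := digit b c t - 1) (by simp [hc₂.ctx.reg1]) fun hs₅ => ?_)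
      refine WP.seq' (WP.load hs₅ (v := v t) (by simp [h20, hc₂.arr7]) fun hs₆ => ?_)
      refine WP.seq' (WP.load hs₆ (v := u t) (by simp [h20, hc₂.arr6]) fun hs₇ => ?_)
      refine WP.ite hs₇ (fun h1 => ?_) fun h1 => ?_
      · have h1' : digit b c t ≠ 1 := by
          simp at h1
          omega
        rw [if_neg h1']
        refine WP.store hs₇ (i := v t) (v := 1) (by simp) (by simp [hc₂.ctx.reg1]) (by omega)
          fun _ => ⟨by simp, Marks.insert fun x hx => hm₂ x hx⟩
      · have h1' : digit b c t = 1 := by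
          simp at h1
          omega
        rw [if_pos h1']
        refine WP.store hs₇ (i := u t) (v := 1) (by simp) (by simp [hc₂.ctx.reg1]) (by omega)
          fun _ => ⟨by simp, Marks.insert fun x hx => hm₂ x hx⟩
    · have h0 : digit b c t = 0 := by simpa using h
      rw [if_pos h0]
      exact ⟨by simp, hm₂⟩

/-- Mark the neighbours of the chosen vertices as dominated. -/
def markNeighbors : Prog := forLoop 20 2
  (.instr (.load 10 0 20) ⨟ .instr (.op .div 11 20 0) ⨟ .instr (.op .mod 12 20 0) ⨟
    .instr (.load 13 8 11) ⨟ .instr (.op .mul 10 10 13) ⨟ .ite 10 (.instr (.store 9 12 1)) skip)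

/-- Both properties of the marks matter: that they are justified makes the result dominating for
every guess, and that no neighbour is missed makes it optimal for the right one. -/
theorem wp_markNeighbors (hs : Bounded N s) (hN : n * n + n + 4 ≤ N) (hc : Ctx n H s)
    (hm : Marks n 8 X s) (hm' : Marks n 9 ∅ s) (hX : X ⊆ Finset.range n) :
    WP N markNeighbors s fun s' => ∃ M, Marks n 9 M s' ∧ Dominated H X M ∧
      ∀ x < n, ∀ y ∈ X, H.Adj x y → x ∈ M := by
  refine (WP.forLoop (r := 20) (M := n * n) (I := fun e s' => ∃ M, Marks n 9 M s' ∧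
    Dominated H X M ∧ ∀ e' < e, e' / n ∈ X → H.Adj (e' / n) (e' % n) → e' % n ∈ M) hs hc.reg2
    (by omega) hc.reg1 (by decide) (fun _ _ _ _ h => h) ?_ ?_).mono ?_
  · exact ⟨∅, hm', fun v hv => by simp at hv, by omega⟩
  · rintro e s₁ he hs₁ hsame h20 ⟨M, h1, h2, h3⟩
    have hc₁ := hc.sameOff hsame
    have hm₁ := hm.sameOff hsame
    obtain ⟨hi, hj⟩ := div_mod_lt he
    refine WP.seq' (WP.load hs₁ (v := if H.Adj (e / n) (e % n) then 1 else 0)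
      (by rw [h20]; exact hc₁.adj e he) fun hs₂ => ?_)
    refine WP.seq' (WP.div hs₂ (v := e / n) (by simp [h20, hc₁.reg0]) fun hs₃ => ?_)
    refine WP.seq' (WP.mod hs₃ (v := e % n) (by simp [h20, hc₁.reg0]) fun hs₄ => ?_)
    refine WP.seq' (WP.load hs₄ (v := if e / n ∈ X then 1 else 0) (by simpa using hm₁ _ hi)
      fun hs₅ => ?_)
    refine WP.seq' (WP.mul hs₅ (v := if H.Adj (e / n) (e % n) ∧ e / n ∈ X then 1 else 0) ?_ ?_
      fun hs₆ => ?_)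
    · by_cases g1 : H.Adj (e / n) (e % n) <;> by_cases g2 : e / n ∈ X <;> simp [g1, g2]
    · exact lt_four_pow_of_le (by split_ifs <;> omega)
    refine WP.ite hs₆ (fun h => ?_) fun h => wp_skip hs₆ ⟨M, h1, h2, fun e' he' g1 g2 => ?_⟩
    · have hcond : H.Adj (e / n) (e % n) ∧ e / n ∈ X := by
        by_contra hcon
        exact h (by simp [hcon])
      refine WP.store hs₆ (i := e % n) (v := 1) (by simp) (by simp [hc₁.reg1]) (by omega)
        fun _ => ⟨insert (e % n) M, Marks.insert fun x hx => h1 x hx, fun w hw => ?_,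
          fun e' he' g1 g2 => ?_⟩
      · rcases Finset.mem_insert.1 hw with rfl | hw
        · exact .inr ⟨_, hcond.2, hcond.1.symm⟩
        · exact h2 w hw
      · rcases Nat.lt_succ_iff_lt_or_eq.1 he' with he' | rfl
        · exact Finset.mem_insert_of_mem (h3 e' he' g1 g2)
        · exact Finset.mem_insert_self _ _
    · rcases Nat.lt_succ_iff_lt_or_eq.1 he' with he' | rfl
      · exact h3 e' he' g1 g2
      · simp [g1, g2] at h
  · rintro s₁ - - ⟨M, h1, h2, h3⟩
    refine ⟨M, h1, h2, fun x hx y hy ha => ?_⟩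
    have hyn : y < n := by simpa using hX hy
    obtain ⟨e1, e2⟩ := mul_add_div_mod y hx
    have := h3 _ (mul_add_lt_sq hyn hx)
    rw [e1, e2] at this
    exact this hy ha.symm

/-- Complete the chosen vertices to a dominating set, from the leaves of the tree to its root. -/
def runGreedy : Prog := forLoop 20 3
  (.instr (.op .sub 10 3 1) ⨟ .instr (.op .sub 10 10 20) ⨟ .instr (.load 10 4 10) ⨟
    .instr (.load 11 5 10) ⨟ .instr (.load 12 8 10) ⨟ .instr (.load 13 9 10) ⨟
    .ite 12 (.instr (.store 9 11 1)) (.ite 13 skip (.instr (.store 8 11 1))))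

theorem wp_runGreedy (hs : Bounded N s) (hN : n * n + n + 4 ≤ N)
    (hc : GuessCtx n H cnt ord par b k u v s) (ht : IsTreeOrder H W cnt ord par)
    (hW : W ⊆ Finset.range n) (hm : Marks n 8 X s) (hm' : Marks n 9 M s)
    (hX : X ⊆ W) (hM : Dominated H X M) :
    WP N runGreedy s fun s' => ∃ I M', Marks n 8 I s' ∧
      IsGreedyState H W cnt ord par X M 0 I M' := by
  have hcn : cnt ≤ n := by
    have := Finset.card_le_card hW
    rwa [ht.card_eq, Finset.card_range] at this
  refine (WP.forLoop (r := 20) (M := cnt) (I := fun t s' => ∃ I M', Marks n 8 I s' ∧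
    Marks n 9 M' s' ∧ IsGreedyState H W cnt ord par X M (cnt - t) I M') hs hc.reg3
    (by omega) hc.ctx.reg1 (by decide) (fun _ _ _ _ h => h) ?_ ?_).mono ?_
  · exact ⟨X, M, hm, hm', IsGreedyState.start hX hM⟩
  · rintro t s₁ htc hs₁ hsame h20 ⟨I, M', h1, h2, h3⟩
    have hc₁ := hc.sameOff hsame
    -- Round `t` treats position `m = cnt - 1 - t`, which runs through the tree order backwards.
    obtain ⟨m, hmc⟩ : ∃ m, cnt - t = m + 1 := ⟨cnt - t - 1, by omega⟩
    rw [hmc] at h3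
    have hstep := h3.step ht (by omega)
    rw [show cnt - (t + 1) = m by omega]
    have hvn : ord m < n := by simpa using hW (ht.mem m (by omega))
    have hpn : par (ord m) < n := by simpa using hW (ht.par_mem (ht.mem m (by omega)))
    refine WP.seq' (WP.sub hs₁ (v := cnt - 1) (by rw [hc₁.reg3, hc₁.ctx.reg1]) fun hs₂ => ?_)
    refine WP.seq' (WP.sub hs₂ (v := m) (by simp [h20]; omega) fun hs₃ => ?_)
    refine WP.seq' (WP.load hs₃ (v := ord m) (by simp [hc₁.arr4]) fun hs₄ => ?_)
    refine WP.seq' (WP.load hs₄ (v := par (ord m)) (by simp [hc₁.arr5]) fun hs₅ => ?_)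
    refine WP.seq' (WP.load hs₅ (v := if ord m ∈ I then 1 else 0) (by simpa using h1 _ hvn)
      fun hs₆ => ?_)
    refine WP.seq' (WP.load hs₆ (v := if ord m ∈ M' then 1 else 0) (by simpa using h2 _ hvn)
      fun hs₇ => ?_)
    refine WP.ite hs₇ (fun h => ?_) fun h => WP.ite hs₇ (fun h' => wp_skip hs₇ ?_) fun h' => ?_
    · have hI : ord m ∈ I := by simpa using h
      simp only [greedyIn, greedyDom, hI, if_true] at hstep
      exact WP.store hs₇ (i := par (ord m)) (v := 1) (by simp) (by simp [hc₁.ctx.reg1])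
        (by omega) fun _ => ⟨_, _, fun x hx => by simpa using h1 x hx,
          Marks.insert fun x hx => h2 x hx, hstep⟩
    · have hI : ord m ∉ I := by simpa using h
      have hM' : ord m ∈ M' := by simpa using h'
      simp only [greedyIn, greedyDom, hI, hM', if_true, if_false] at hstep
      exact ⟨_, _, h1, h2, hstep⟩
    · have hI : ord m ∉ I := by simpa using h
      have hM' : ord m ∉ M' := by simpa using h'
      simp only [greedyIn, greedyDom, hI, hM', if_false] at hstep
      exact WP.store hs₇ (i := par (ord m)) (v := 1) (by simp) (by simp [hc₁.ctx.reg1])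
        (by omega) fun _ => ⟨_, _, Marks.insert fun x hx => h1 x hx,
          fun x hx => by simpa using h2 x hx, hstep⟩
  · rintro s₁ - - ⟨I, M', h1, -, h3⟩
    exact ⟨I, M', h1, by simpa using h3⟩

/-- Count the chosen vertices in register `10`. -/
def countChosen : Prog :=
  .instr (.const 10 0) ⨟ forLoop 20 0 (.instr (.load 11 8 20) ⨟ .instr (.op .add 10 10 11))

theorem wp_countChosen (hs : Bounded N s) (hN : n * n + n + 4 ≤ N) (hc : Ctx n H s)
    (hm : Marks n 8 I s) (hI : I ⊆ Finset.range n) :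
    WP N countChosen s fun s' => s'.reg 10 = I.card := by
  refine WP.seq' (WP.const hs (by decide) (by positivity) fun hs₁ => ?_)
  have hc₁ := hc.setReg (d := 10) (v := 0)
  refine (WP.forLoop (r := 20) (M := n) (I := fun i s' => s'.reg 10 =
    ((Finset.range i).filter (· ∈ I)).card) hs₁ hc₁.reg0 (by omega) hc₁.reg1 (by decide)
    (by intros; simpa) (by simp) ?_).mono fun s₂ _ _ h => ?_
  · intro i s₂ hi hs₂ hsame h20 h10
    have hm₂ : s₂.arr (8, i) = if i ∈ I then 1 else 0 :=
      (hsame.arr 8 (by decide) i).trans (hm i hi)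
    have hle : ((Finset.range (i + 1)).filter (· ∈ I)).card ≤ i + 1 :=
      (Finset.card_filter_le _ _).trans_eq (Finset.card_range _)
    have hval : ((Finset.range i).filter (· ∈ I)).card + (if i ∈ I then 1 else 0) =
        ((Finset.range (i + 1)).filter (· ∈ I)).card := by
      rw [Finset.range_add_one, Finset.filter_insert]
      split_ifs with h
      · rw [Finset.card_insert_of_notMem (by simp)]
      · rfl
    refine WP.seq' (WP.load hs₂ (v := if i ∈ I then 1 else 0) (by rw [h20, hm₂]) fun hs₃ => ?_)
    exact WP.add hs₃ (v := ((Finset.range (i + 1)).filter (· ∈ I)).card) (by simp [h10, hval])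
      (lt_four_pow_of_le (by omega)) fun _ => by simp
  · rw [h, Finset.filter_mem_eq_inter, Finset.inter_eq_right.2 hI]

/-- Keep the chosen set if it is smaller than the best set so far. -/
def keepBest : Prog :=
  .instr (.op .sub 11 8 10) ⨟ .ite 11 (.instr (.op .add 8 10 9) ⨟
    forLoop 20 0 (.instr (.load 12 8 20) ⨟ .instr (.store 1 20 12))) skip

theorem wp_keepBest (hs : Bounded N s) (hN : n * n + n + 4 ≤ N) (hc : Ctx n H s)
    (hm : Marks n 8 I s) {x y : ℕ} (h8 : s.reg 8 = x) (h10 : s.reg 10 = y) :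
    WP N keepBest s fun s' => (y < x ∧ s'.reg 8 = y ∧ Marks n 1 I s') ∨
      (x ≤ y ∧ s'.reg 8 = x ∧ ∀ v, s'.arr (1, v) = s.arr (1, v)) := by
  refine WP.seq' (WP.sub hs (v := x - y) (by rw [h8, h10]) fun hs₁ => ?_)
  refine WP.ite hs₁ (fun h => ?_) fun h => wp_skip hs₁ (.inr ⟨?_, by simp [h8], fun v => rfl⟩)
  · have hlt : y < x := by
      simp at h
      omega
    refine WP.seq' (WP.add hs₁ (v := y) (by simp [h10, hc.reg9]) (h10 ▸ hs.reg_lt 10)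
      fun hs₂ => ?_)
    have hc₂ := (hc.setReg (d := 11) (v := x - y)).setReg (d := 8) (v := y)
    refine (WP.forLoop (r := 20) (M := n) (I := fun i s' => ∀ v < i,
      s'.arr (1, v) = if v ∈ I then 1 else 0) hs₂ hc₂.reg0 (by omega) hc₂.reg1 (by decide)
      (fun _ _ _ _ h => h) (by simp) ?_).mono fun s₃ _ hsame h => .inl ⟨hlt, ?_, h⟩
    · intro i s₃ hi hs₃ hsame h20 hI
      have hm₃ : s₃.arr (8, i) = if i ∈ I then 1 else 0 :=
        (hsame.arr 8 (by decide) i).trans (hm i hi)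
      refine WP.seq' (WP.load hs₃ (by rw [h20, hm₃]) fun hs₄ => ?_)
      refine WP.store hs₄ (i := i) (v := if i ∈ I then 1 else 0) (by simpa) (by simp) (by omega)
        fun _ t ht => ?_
      rcases Nat.lt_succ_iff_lt_or_eq.1 ht with ht | rfl
      · simp [ht.ne, hI t ht]
      · simp
    · rw [hsame.reg 8 (by decide)]
      simp
  · simp at h
    omega

/-- Treat the guess whose number is in register `30`. -/
def tryGuess : Prog :=
  clearMarks ⨟ decodeGuess ⨟ markNeighbors ⨟ runGreedy ⨟ countChosen ⨟ keepBest

/-- The set `D` is a solution that agrees with the guess `c`. -/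
def AgreesWithGuess (H : SimpleGraph ℕ) (W : Finset ℕ) (cnt : ℕ) (ord par : ℕ → ℕ) (b k : ℕ)
    (u v : ℕ → ℕ) (c : ℕ) (D : Finset ℕ) : Prop :=
  ∀ M : Finset ℕ, (∀ x ∈ W, ∀ y ∈ guessSet u v (digit b c) k, H.Adj x y → x ∈ M) →
    IsResidual cnt ord par cnt (guessSet u v (digit b c) k) M D

/-- The resulting set dominates whatever the guess; its size is compared only with the sets `D` for
which the guess is right. -/
theorem wp_tryGuess (hs : Bounded N s) (hN : n * n + n + 4 ≤ N)
    (hc : GuessCtx n H cnt ord par b k u v s) (hk : k < N) (ht : IsTreeOrder H W cnt ord par)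
    (hW : W ⊆ Finset.range n) (hg : IsGuessSystem H W cnt ord par b k u v) {c : ℕ}
    (h30 : s.reg 30 = c) {x : ℕ} (h8 : s.reg 8 = x) :
    WP N tryGuess s fun s' => ∃ I ⊆ W, Dominated H I W ∧
      (∀ D, AgreesWithGuess H W cnt ord par b k u v c D → I.card ≤ D.card) ∧
      ((I.card < x ∧ s'.reg 8 = I.card ∧ Marks n 1 I s') ∨
        (x ≤ I.card ∧ s'.reg 8 = x ∧ ∀ v, s'.arr (1, v) = s.arr (1, v))) := by
  set X := guessSet u v (digit b c) k with hX'
  have hX : X ⊆ W := by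
    intro w hw
    obtain ⟨t, htk, -, rfl⟩ := mem_guessSet.1 hw
    split_ifs
    · exact (hg.mem t htk).1
    · exact (hg.mem t htk).2
  refine WP.seq (wp_clearMarks hs hN hc.ctx) fun s₁ hs₁ hsame₁ ⟨h1, h1'⟩ => ?_
  have hc₁ := hc.sameOff hsame₁
  refine WP.seq (wp_decodeGuess hs₁ hN hc₁ hk h1 (fun t ht => ?_)
    ((hsame₁.reg 30 (by decide)).trans h30)) fun s₂ hs₂ hsame₂ h2 => ?_
  · exact ⟨by simpa using hW (hg.mem t ht).1, by simpa using hW (hg.mem t ht).2⟩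
  have hc₂ := hc₁.sameOff hsame₂
  refine WP.seq (wp_markNeighbors hs₂ hN hc₂.ctx h2 (h1'.sameOff hsame₂) (hX.trans hW))
    fun s₃ hs₃ hsame₃ ⟨M, h3, h3', h3''⟩ => ?_
  have hc₃ := hc₂.sameOff hsame₃
  refine WP.seq (wp_runGreedy hs₃ hN hc₃ ht hW (h2.sameOff hsame₃) h3 hX h3')
    fun s₄ hs₄ hsame₄ ⟨I, M', h4, h4'⟩ => ?_
  have hc₄ := hc₃.sameOff hsame₄
  refine WP.seq (wp_countChosen hs₄ hN hc₄.ctx h4 (h4'.sub.trans hW))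
    fun s₅ hs₅ hsame₅ h5 => ?_
  have hc₅ := hc₄.sameOff hsame₅
  refine (wp_keepBest hs₅ hN hc₅.ctx (h4.sameOff hsame₅) (x := x) ?_ h5).mono
    fun s₆ hs₆ hsame₆ h6 => ⟨I, h4'.sub, h4'.dominated ht, fun D hD => h4'.card_le (hD M ?_), ?_⟩
  · rw [hsame₅.reg 8 (by decide), hsame₄.reg 8 (by decide), hsame₃.reg 8 (by decide),
      hsame₂.reg 8 (by decide), hsame₁.reg 8 (by decide), h8]
  · exact fun y hy => h3'' y (by simpa using hW hy)
  · refine h6.imp_right fun h6 => ⟨h6.1, h6.2.1, fun v => ?_⟩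
    rw [h6.2.2, hsame₅.arr 1 (by decide), hsame₄.arr 1 (by decide), hsame₃.arr 1 (by decide),
      hsame₂.arr 1 (by decide), hsame₁.arr 1 (by decide)]

end

end RAM

/-! ### The minimum over all guesses -/

namespace RAM

/-- Try all guesses. -/
def tryAll : Prog := forLoop 30 7 tryGuess

theorem guessSet_congr {u v δ δ' : ℕ → ℕ} {k : ℕ} (h : ∀ t < k, δ t = δ' t) :
    guessSet u v δ k = guessSet u v δ' k := by
  ext w
  simp only [mem_guessSet]
  refine exists_congr fun t => and_congr_right fun ht => ?_
  rw [h t ht]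

/-- The best size so far is at most that of every set agreeing with an earlier guess. By
completeness and the digit expansion, every dominating set agrees with some guess below `b ^ k`. -/
theorem wpt_tryAll {n N : ℕ} {H : SimpleGraph ℕ} [DecidableRel H.Adj] {s : State} {W : Finset ℕ}
    (hs : Bounded N s) (hN : n * n + n + 4 ≤ N) (hc : Ctx n H s) (hW : W ⊆ Finset.range n)
    (ht : HasTree H W s) (hg : HasGuesses N H W s) (h8 : s.reg 8 = n + 1) :
    WPT N (s.reg 7 * (tryGuess.steps N + 3) + 3) tryAll s fun s' => ∃ D ⊆ W, Dominated H D W ∧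
      Marks n 1 D s' ∧ ∀ D' ⊆ W, Dominated H D' W → D.card ≤ D'.card := by
  set ord := fun t => s.arr (4, t)
  set par := fun t => s.arr (5, t)
  set u := fun t => s.arr (6, t)
  set v := fun t => s.arr (7, t)
  have hgc : GuessCtx n H (s.reg 3) ord par (s.reg 5) (s.reg 6) u v s :=
    ⟨hc, rfl, rfl, rfl, fun _ => rfl, fun _ => rfl, fun _ => rfl, fun _ => rfl⟩
  refine (WPT.forLoop (r := 30) (M := s.reg 7) (body := tryGuess) (I := fun c s' =>
    ((s'.reg 8 = n + 1 ∧ c = 0) ∨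
      ∃ D ⊆ W, Dominated H D W ∧ Marks n 1 D s' ∧ D.card = s'.reg 8) ∧
    ∀ c' < c, ∀ D, AgreesWithGuess H W (s.reg 3) ord par (s.reg 5) (s.reg 6) u v c' D →
      s'.reg 8 ≤ D.card) hs rfl hg.lt_pow hc.reg1 (by decide) ?_ ?_ ?_).mono le_rfl ?_
  · rintro c s' x y ⟨h1, h2⟩
    exact ⟨by simpa [Marks] using h1, by simpa using h2⟩
  · exact ⟨.inl ⟨h8, rfl⟩, by omega⟩
  · rintro c s₁ hcM hs₁ hsame h30 ⟨h1, h2⟩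
    refine (wp_tryGuess hs₁ hN (hgc.sameOff hsame) hg.lt ht hW hg.sys h30 rfl).mono
      fun s₂ _ _ ⟨I, k1, k2, k3, k4⟩ => ?_
    rcases k4 with ⟨l1, l2, l3⟩ | ⟨l1, l2, l3⟩
    · refine ⟨.inr ⟨I, k1, k2, l3, l2.symm⟩, fun c' hc' D hD => ?_⟩
      rcases Nat.lt_succ_iff_lt_or_eq.1 hc' with hc' | rfl
      · have := h2 c' hc' D hD
        omega
      · exact l2 ▸ k3 D hD
    · refine ⟨.inr ?_, fun c' hc' D hD => ?_⟩
      -- The initial value `n + 1` exceeds the size of every subset of `W`, so the first guess is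
      -- always kept.
      · rcases h1 with ⟨h1, -⟩ | ⟨D, m1, m2, m3, m4⟩
        · have := Finset.card_le_card (k1.trans hW)
          rw [Finset.card_range] at this
          omega
        · exact ⟨D, m1, m2, fun v hv => by rw [l3, m3 v hv], by rw [l2, m4]⟩
      · rcases Nat.lt_succ_iff_lt_or_eq.1 hc' with hc' | rfl
        · exact l2 ▸ h2 c' hc' D hD
        · have := k3 D hD
          omega
  · rintro s₁ - - ⟨h1, h2⟩
    -- There is at least one guess, hence some set has been kept.
    have hpos : 0 < s.reg 7 := by
      rw [hg.pow]
      exact Nat.pow_pos (by have := hg.sys.two_le; omega)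
    rcases h1 with ⟨-, h1⟩ | ⟨D, m1, m2, m3, m4⟩
    · omega
    · refine ⟨D, m1, m2, m3, fun D' hD' hdom => ?_⟩
      obtain ⟨δ, hδ, hsub, hres⟩ := hg.sys.complete D' hD' hdom
      obtain ⟨c, hcl, hdig⟩ := exists_digits hg.sys.two_le δ _ hδ
      rw [m4]
      refine h2 c (by rw [hg.pow]; exact hcl) D' fun M hM => ?_
      have heq : guessSet u v (digit (s.reg 5) c) (s.reg 6) = guessSet u v δ (s.reg 6) :=
        guessSet_congr hdig
      rw [heq] at hM ⊢
      exact hres M hM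

/-! ## The input -/

theorem inputState_reg {n : ℕ} (G : SimpleGraph (Fin n)) (r : ℕ) :
    (inputState G).reg r = if r = 0 then n else 0 := by
  simp [inputState, Finsupp.single_apply, eq_comm]

open Classical in
theorem inputState_arr {n : ℕ} (G : SimpleGraph (Fin n)) (k e : ℕ) :
    (inputState G).arr (k, e) = if k = 0 ∧ e < n * n ∧
      (G.map Fin.valEmbedding).Adj (e / n) (e % n) then 1 else 0 := by
  simp only [inputState, Finsupp.onFinset_apply]
  congr 1
  rw [eq_iff_iff]
  constructor
  · rintro ⟨i, j, ha, he⟩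
    obtain ⟨rfl, rfl⟩ := Prod.mk.inj he
    refine ⟨rfl, mul_add_lt_sq i.isLt j.isLt, ?_⟩
    rw [mul_comm, Nat.mul_add_div i.pos, Nat.div_eq_of_lt j.isLt, add_zero,
      Nat.mul_add_mod, Nat.mod_eq_of_lt j.isLt]
    exact map_val_adj_iff.2 ha
  · rintro ⟨rfl, he, ha⟩
    obtain ⟨hi, hj⟩ := div_mod_lt he
    refine ⟨⟨_, hi⟩, ⟨_, hj⟩, map_val_adj_iff.1 ha, ?_⟩
    simp only [Prod.mk.injEq, true_and]
    rw [mul_comm, Nat.div_add_mod]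

theorem bounded_inputState {n N : ℕ} (hN : n * n + n + 4 ≤ N) (G : SimpleGraph (Fin n)) :
    Bounded N (inputState G) := by
  classical
  refine ⟨fun r hr => ?_, fun r => ?_, fun k i h => ?_, fun ⟨k, i⟩ => ?_⟩
  · rw [inputState_reg, if_neg (by omega)]
  · rw [inputState_reg]
    exact lt_four_pow_of_le (by split_ifs <;> omega)
  · rw [inputState_arr, if_neg]
    rintro ⟨h1, h2, -⟩
    omega
  · rw [inputState_arr]
    exact lt_four_pow_of_le (by split_ifs <;> omega)

section

variable {n : ℕ} {G : SimpleGraph (Fin n)} {W : Finset ℕ}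

theorem isCutConnected_map (hW : W ⊆ Finset.range n)
    (h : IsCutConnected G (finPart n W)) :
    IsCutConnected (G.map Fin.valEmbedding) (W : Set ℕ) := by
  intro S hS hne hSW
  have hlt : ∀ x ∈ W, x < n := fun x hx => by simpa using hW hx
  have hneq : {v : Fin n | (v : ℕ) ∈ S} ≠ finPart n W := fun e => by
    refine hSW (subset_antisymm hS fun x hx => ?_)
    have : (⟨x, hlt x hx⟩ : Fin n) ∈ finPart n W := hx
    rw [← e] at this
    exact this
  obtain ⟨x, hx⟩ := hne
  obtain ⟨i, hi, j, ⟨hj, hj'⟩, ha⟩ := h {v | (v : ℕ) ∈ S} (fun v hv => hS hv)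
    ⟨⟨x, hlt x (hS hx)⟩, hx⟩ hneq
  exact ⟨i, hi, j, ⟨hj, hj'⟩, map_val_adj_iff.2 ha⟩

theorem edgesIn_map_subset : edgesIn (G.map Fin.valEmbedding) (W : Set ℕ) ⊆
    Sym2.map Fin.val '' edgesIn G (finPart n W) := by
  rintro e ⟨he, hW⟩
  rw [SimpleGraph.edgeSet_map] at he
  obtain ⟨e, he, rfl⟩ := he
  exact ⟨e, ⟨he, fun x hx => hW _ (Sym2.mem_map.2 ⟨x, hx, rfl⟩)⟩, rfl⟩

theorem ncard_finPart (hW : W ⊆ Finset.range n) : (finPart n W).ncard = W.card := by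
  rw [← Set.ncard_image_of_injective _ Fin.val_injective, ← Set.ncard_coe_finset]
  congr 1
  ext x
  simp only [Set.mem_image, Finset.mem_coe]
  exact ⟨fun ⟨y, hy, e⟩ => e ▸ hy, fun hx => ⟨⟨x, by simpa using hW hx⟩, hx, rfl⟩⟩

end

/-- Everything before the guesses. -/
def prepare : Prog :=
  .instr (.const 1 1) ⨟ .instr (.op .mul 2 0 0) ⨟ .instr (.op .add 8 0 1) ⨟ reduceGraph ⨟
    growTree ⨟ listEdges ⨟ chooseGuesses

theorem wp_prepare {n N : ℕ} {G : SimpleGraph (Fin n)} {U : Set (Fin n)}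
    [DecidableRel (G.map Fin.valEmbedding).Adj] (hN : n * n + n + 4 ≤ N) (hG : G.Connected)
    (hU : G.IsDegreeOneReduction U) (hcard : 5 * Uᶜ.ncard ≤ n) :
    WP N prepare (inputState G) fun s => ∃ W ⊆ Finset.range n, finPart n W = U ∧
      Ctx n (G.map Fin.valEmbedding) s ∧ HasTree (G.map Fin.valEmbedding) W s ∧
      HasGuesses N (G.map Fin.valEmbedding) W s ∧ s.reg 8 = n + 1 ∧
      ∃ f, f + n ≤ G.edgeSet.ncard + 1 ∧ s.reg 7 = min (3 ^ f) (2 ^ W.card) := by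
  have hs := bounded_inputState hN G
  set s₀ := inputState G with hs₀
  have h0 : s₀.reg 0 = n := by simp [hs₀, inputState_reg]
  have h9 : s₀.reg 9 = 0 := by simp [hs₀, inputState_reg]
  have hz : ∀ k, k ≠ 0 → ∀ v, s₀.arr (k, v) = 0 := fun k hk v => by
    classical simp [hs₀, inputState_arr, hk]
  refine WP.seq' (WP.const hs (by decide) (lt_four_pow_of_le (by omega)) fun hs₁ => ?_)
  refine WP.seq' (WP.mul hs₁ (v := n * n) (by simp [h0]) (lt_four_pow_of_le (by omega))
    fun hs₂ => ?_)
  refine WP.seq' (WP.add hs₂ (v := n + 1) (by simp [h0]) (lt_four_pow_of_le (by omega))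
    fun hs₃ => ?_)
  have hc₃ : Ctx n (G.map Fin.valEmbedding)
      (((s₀.setReg 1 1).setReg 2 (n * n)).setReg 8 (n + 1)) := by
    refine ⟨by simp [h0], by simp, by simp, by simp [h9], fun e he => ?_⟩
    simp only [State.setReg_arr, hs₀]
    classical
    rw [inputState_arr]
    simp [he]
  refine WP.seq (wp_reduceGraph hs₃ hN hc₃ (fun v => by simpa using hz 2 (by decide) v))
    fun s₄ hs₄ hsame₄ ⟨W, hW, hred, hd⟩ => ?_
  -- The machine deletes in an order of its own; uniqueness identifies its result with the given
  -- `U`.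
  have hWU := reduction_unique hG hU hred hcard
  have hWcut := isCutConnected_map hW (reduction_isCutConnected hG hred.1)
  have hadd := Set.ncard_add_ncard_compl U
  rw [Nat.card_eq_fintype_card, Fintype.card_fin] at hadd
  have hne : W.Nonempty := by
    obtain ⟨x⟩ := hG.nonempty
    have := x.pos
    rw [← Finset.card_pos, ← ncard_finPart hW, hWU]
    omega
  have hc₄ := hc₃.sameOff hsame₄
  refine WP.seq (wp_growTree hs₄ hN hc₄ hd hW hne hWcut
    (fun v => by rw [hsame₄.arr 3 (by decide)]; simpa using hz 3 (by decide) v))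
    fun s₅ hs₅ hsame₅ ht => ?_
  have hc₅ := hc₄.sameOff hsame₅
  refine WP.seq (wp_listEdges hs₅ hN hc₅ (hd.sameOff hsame₅) hW ht)
    fun s₆ hs₆ hsame₆ hl => ?_
  have hc₆ := hc₅.sameOff hsame₆
  have ht₆ := ht.sameOff hsame₆
  have hl₆ : ListsEdges (G.map Fin.valEmbedding) W (fun v => s₆.arr (5, v)) n (n * n) s₆ := by
    have : (fun v => s₆.arr (5, v)) = fun v => s₅.arr (5, v) :=
      funext fun v => hsame₆.arr 5 (by decide) v
    rwa [this]
  refine (wp_chooseGuesses hs₆ hN hc₆ hW ht₆ hl₆).mono fun s₇ hs₇ hsame₇ ⟨hg, h7⟩ => ?_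
  refine ⟨W, hW, hWU, hc₆.sameOff hsame₇, ht₆.sameOff hsame₇, hg, ?_, s₆.reg 4, ?_,
    by rw [h7, ht₆.card_eq]⟩
  · rw [hsame₇.reg 8 (by decide), hsame₆.reg 8 (by decide), hsame₅.reg 8 (by decide),
      hsame₄.reg 8 (by decide)]
    simp
  -- With `e` edges inside `W`, `f + |W| ≤ e + 1` and `e + n ≤ m + |W|` give the bound, since `|W|`
  -- and `e` cancel.
  · have hfin : (Sym2.map Fin.val '' edgesIn G (finPart n W)).Finite := Set.toFinite _
    have h1 := IsTreeOrder.card_nonTreeEdges_add_le ht₆ (fun t ht => (hl₆.mem t ht).1)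
      (fun t ht t' ht' => hl₆.inj t ht t' ht') (hfin.subset edgesIn_map_subset)
    have h2 := Set.ncard_le_ncard (edgesIn_map_subset (G := G) (W := W)) hfin
    have h3 := Set.ncard_image_le (f := Sym2.map Fin.val) (Set.toFinite (edgesIn G (finPart n W)))
    have h4 := reduction_card hred.1
    rw [ncard_finPart hW, ht₆.card_eq] at h4
    omega

/-! ## The main program -/

/-- Minimum domination of the degree-one reduction. -/
def dominationProgram : Prog := prepare ⨟ tryAll

/-- As there is at least one guess, the time of the preparation is absorbed into the multiple of the
number of guesses. -/
theorem time_le {a b c : ℕ} {x : ℝ} (hc : 1 ≤ c) (hx : (c : ℝ) ≤ 2 * x) :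
    ((a + (c * (b + 3) + 3) : ℕ) : ℝ) ≤ (2 * (a + b + 6) : ℕ) * x := by
  have hle : a + (c * (b + 3) + 3) ≤ c * (a + b + 6) := by
    nlinarith [Nat.mul_le_mul_right (a + 3) hc]
  calc ((a + (c * (b + 3) + 3) : ℕ) : ℝ) ≤ ((c * (a + b + 6) : ℕ) : ℝ) := by exact_mod_cast hle
    _ = (c : ℝ) * (a + b + 6 : ℕ) := by push_cast; ring
    _ ≤ (2 * x) * (a + b + 6 : ℕ) := by gcongr
    _ = _ := by push_cast; ring

/-- Fifth powers clear the denominator, and `5f + 2c ≤ 5(m + 1 - n) + 2n = 5m + 5 - 3n`. The factor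
`2` on the right comes from the `+ 1`. -/
theorem total_le {f n m c : ℕ} (hf : f + n ≤ m + 1) (hc : c ≤ n) :
    ((min (3 ^ f) (2 ^ c) : ℕ) : ℝ) ≤ 2 * (2 : ℝ) ^ ((m : ℝ) - 3 * (n : ℝ) / 5) := by
  have h5 : ((min (3 ^ f) (2 ^ c) : ℕ) : ℝ) ^ 5 ≤ 2 ^ (5 * f + 2 * c) := by
    exact_mod_cast min_pow_five_le f c
  have hpow : (2 * (2 : ℝ) ^ ((m : ℝ) - 3 * (n : ℝ) / 5)) ^ 5 =
      (2 : ℝ) ^ (5 * (m : ℝ) + 5 - 3 * n) := by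
    rw [← Real.rpow_one_add' (by norm_num), ← Real.rpow_natCast, ← Real.rpow_mul (by norm_num)]
    · congr 1
      push_cast
      ring
    -- The exponent `1 + m - 3n/5` must not vanish: `5m + 5 = 3n` contradicts `n ≤ m + 1`.
    · intro h
      have h1 : (5 * m + 5 : ℝ) = 3 * n := by linarith
      have h2 : 5 * m + 5 = 3 * n := by exact_mod_cast h1
      omega
  refine le_of_pow_le_pow_left₀ (n := 5) (by norm_num) (by positivity) (h5.trans ?_)
  rw [hpow, ← Real.rpow_natCast]
  refine Real.rpow_le_rpow_of_exponent_le (by norm_num) ?_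
  have h1 : (f : ℝ) + n ≤ m + 1 := by exact_mod_cast hf
  have h2 : (c : ℝ) ≤ n := by exact_mod_cast hc
  push_cast
  linarith

theorem isMinimumDominatingSet_of_dominated {n : ℕ} {G : SimpleGraph (Fin n)} {W D : Finset ℕ}
    (hW : W ⊆ Finset.range n) (hD : D ⊆ W) (hdom : Dominated (G.map Fin.valEmbedding) D W)
    (hmin : ∀ D' ⊆ W, Dominated (G.map Fin.valEmbedding) D' W → D.card ≤ D'.card) :
    (G.induce (finPart n W)).IsMinimumDominatingSet {x | ((x : Fin n) : ℕ) ∈ D} := by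
  have hinj : Function.Injective fun x : finPart n W => ((x : Fin n) : ℕ) :=
    Fin.val_injective.comp Subtype.val_injective
  refine ⟨fun x => ?_, fun D' hD' => ?_⟩
  · refine (hdom _ x.2).imp id fun ⟨w, hw, ha⟩ => ?_
    have hwn : w < n := by simpa using hW (hD hw)
    exact ⟨⟨⟨w, hwn⟩, hD hw⟩, hw, map_val_adj_iff.1 ha⟩
  · set E := (Set.toFinite ((fun x : finPart n W => ((x : Fin n) : ℕ)) '' D')).toFinset with hE
    have h1 : D'.encard = E.card := by
      rw [← hinj.encard_image, ← Set.encard_coe_eq_coe_finsetCard, hE, Set.Finite.coe_toFinset]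
    have h2 : Set.encard {x : finPart n W | ((x : Fin n) : ℕ) ∈ D} = D.card := by
      rw [← hinj.encard_image, ← Set.encard_coe_eq_coe_finsetCard]
      congr 1
      ext w
      simp only [Set.mem_image, Set.mem_ofPred_eq, Finset.mem_coe]
      exact ⟨fun ⟨y, hy, e⟩ => e ▸ hy, fun hw =>
        ⟨⟨⟨w, by simpa using hW (hD hw)⟩, hD hw⟩, hw, rfl⟩⟩
    rw [h1, h2]
    have : D.card ≤ E.card := by
      refine hmin E (fun w hw => ?_) fun w hw => ?_
      · obtain ⟨x, -, rfl⟩ := (Set.Finite.mem_toFinset _).1 hw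
        exact x.2
      · have hwn : w < n := by simpa using hW hw
        refine (hD' ⟨⟨w, hwn⟩, hw⟩).imp (fun h => ?_) fun ⟨y, hy, ha⟩ => ?_
        · exact (Set.Finite.mem_toFinset _).2 ⟨_, h, rfl⟩
        · exact ⟨_, (Set.Finite.mem_toFinset _).2 ⟨y, hy, rfl⟩, map_val_adj_iff.2 ha⟩
    exact_mod_cast this

theorem wpt_dominationProgram {n N : ℕ} {G : SimpleGraph (Fin n)} {U : Set (Fin n)}
    (hN : n * n + n + 4 ≤ N) (hG : G.Connected) (hU : G.IsDegreeOneReduction U)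
    (hcard : 5 * Uᶜ.ncard ≤ n) :
    ∃ T : ℕ, (T : ℝ) ≤ (2 * (prepare.steps N + tryGuess.steps N + 6) : ℕ) *
        (2 : ℝ) ^ ((G.edgeSet.ncard : ℝ) - 3 * (n : ℝ) / 5) ∧
      WPT N T dominationProgram (inputState G) fun s => ∃ D : Set U,
        (G.induce U).IsMinimumDominatingSet D ∧ s.Outputs (Subtype.val '' D) := by
  classical
  obtain ⟨s₁, t₁, b₁, r₁, ht₁, hb₁, hs₁, W, hW, rfl, hc, htree, hg, h8, f, hf, h7⟩ :=
    wp_prepare hN hG hU hcard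
  obtain ⟨s₂, t₂, b₂, r₂, ht₂, hb₂, hs₂, D, hD, hdom, hm, hmin⟩ :=
    wpt_tryAll hs₁ hN hc hW htree hg h8
  refine ⟨prepare.steps N + (s₁.reg 7 * (tryGuess.steps N + 3) + 3), ?_, s₂, _, _, .seq r₁ r₂,
    by rw [add_mul]; exact add_le_add ht₁ ht₂, max_le hb₁ hb₂, hs₂,
    {x | ((x : Fin n) : ℕ) ∈ D}, isMinimumDominatingSet_of_dominated hW hD hdom hmin, ?_⟩
  · have hWn : W.card ≤ n := by simpa using Finset.card_le_card hW
    have htot := total_le hf hWn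
    rw [← h7] at htot
    have hpos : 1 ≤ s₁.reg 7 := by
      rw [h7]
      exact le_min (Nat.one_le_pow _ _ (by norm_num)) (Nat.one_le_pow _ _ (by norm_num))
    exact time_le hpos htot
  · intro v
    have hv := hm v v.isLt
    constructor
    · rintro ⟨x, hx, rfl⟩
      exact hv.trans (if_pos hx)
    · exact fun hnot => hv.trans (if_neg fun h => hnot ⟨⟨v, hD h⟩, h, rfl⟩)

end RAM

theorem mainTheorem6 :
    ∃ (P : RAM.Prog) (p q : Polynomial ℕ),
      ∀ (n : ℕ) (G : SimpleGraph (Fin n)) (U : Set (Fin n)),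
        G.Connected →
        G.IsDegreeOneReduction U →
        ((Uᶜ.ncard : ℕ) : ℝ) ≤ (n : ℝ) / 5 →
        ∃ (s : RAM.State) (t b : ℕ) (D : Set U),
          P.Runs (RAM.inputState G) s t b ∧
          (G.induce U).IsMinimumDominatingSet D ∧
          s.Outputs (Subtype.val '' D) ∧
          (t : ℝ) ≤ ((p.eval n : ℕ) : ℝ) * (2 : ℝ) ^ ((G.edgeSet.ncard : ℝ) - 3 * (n : ℝ) / 5) ∧
          b ≤ q.eval n := by
  obtain ⟨P₁, hP₁⟩ := RAM.prepare.exists_polynomial_steps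
  obtain ⟨P₂, hP₂⟩ := RAM.tryGuess.exists_polynomial_steps
  -- `N = n ^ 2 + n + 4` is large enough for the cells of the adjacency matrix, the number of
  -- non-tree edges, the loop bounds, the start value `n + 1` and the constants of the program.
  let R : Polynomial ℕ := Polynomial.X * Polynomial.X + Polynomial.X + 4
  let q : Polynomial ℕ := 64 * (6 + 2 * Polynomial.X) +
    16 * Polynomial.X * (4 + Polynomial.X + 2 * Polynomial.X)
  refine ⟨RAM.dominationProgram,
    (2 * (P₁ + P₂ + 6) * (2 * Polynomial.X + 1) ^ 2).comp R, q.comp R, fun n G U hG hU hcard => ?_⟩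
  have hcard' : 5 * Uᶜ.ncard ≤ n := by
    have : (5 * Uᶜ.ncard : ℝ) ≤ n := by linarith
    exact_mod_cast this
  have hR : R.eval n = n * n + n + 4 := by simp [R]
  obtain ⟨T, hT, s, t, b, h1, h2, h3, -, D, h4, h5⟩ :=
    RAM.wpt_dominationProgram (N := n * n + n + 4) le_rfl hG hU hcard'
  refine ⟨s, t, b, D, h1, h4, h5, ?_, ?_⟩
  · rw [Polynomial.eval_comp, hR]
    have heval : (2 * (P₁ + P₂ + 6) * (2 * Polynomial.X + 1) ^ 2 : Polynomial ℕ).eval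
        (n * n + n + 4) = 2 * (RAM.prepare.steps (n * n + n + 4) +
          RAM.tryGuess.steps (n * n + n + 4) + 6) * (2 * (n * n + n + 4) + 1) ^ 2 := by
      simp [hP₁, hP₂]
    rw [heval]
    calc (t : ℝ) ≤ ((T * (2 * (n * n + n + 4) + 1) ^ 2 : ℕ) : ℝ) := by exact_mod_cast h2
      _ = (T : ℝ) * ((2 * (n * n + n + 4) + 1) ^ 2 : ℕ) := by push_cast; ring
      _ ≤ _ := mul_le_mul_of_nonneg_right hT (by positivity)
      _ = _ := by push_cast; ring
  · rw [Polynomial.eval_comp, hR]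
    refine h3.trans_eq ?_
    simp [q, RAM.bitBound]
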